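/- Let $\mathcal F^2$ be the Fock space of entire functions $f$ with $\frac1\pi\int_{\mathbb C}|f(z)|^2e^{-|z|^2}\,dV(z)<\infty$. Let $a,b,c\in\mathbb C$ satisfy $|a|=1$, $\bar a b+\bar b=0$, $|c|^2e^{|b|^2}=1$, and let $\mathcal C_{a,b,c}$ be the conjugation (anti-linear isometric involution) $\mathcal C_{a,b,c}f(z)=c\,e^{bz}\,\overline{f(\overline{az+b})}$ on $\mathcal F^2$. Let $(\zeta_t)_{t\ge0}$ be a semiflow, i.e. a family of nonconstant entire functions with $\zeta_0(z)=z$, $\zeta_{t+s}=\zeta_t\circ\zeta_s$ for $t,s\ge 0$, and $t\mapsto\zeta_t(z)$ continuous on $[0,\infty)$ for every $z$. Let $(\xi_t)_{t\ge0}$ be a semicocycle for it, i.e. a family of entire functions with $\xi_0=1$, $\xi_{t+s}=\xi_t\cdot(\xi_s\circ\zeta_t)$ for $t,s\ge0$, and $t\mapsto\xi_t(z)$ differentiable on $[0,\infty)$ for every $z$. For each $t\ge 0$ let $W_{\xi,\zeta}(t)$ be an unbounded weighted composition operator with symbols $\xi_t,\zeta_t$, i.e. a restriction to some linear subspace of the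 maximal operator $W_{\xi,\zeta}(t)_{\max}f=\xi_t\cdot f\circ\zeta_t$, whose domain is $\{f\in\mathcal F^2:\xi_t\cdot f\circ\zeta_t\in\mathcal F^2\}$. A family $(T(t))_{t\ge0}$ of unbounded linear operators on a Hilbert space is called an unbounded $C_0$-semigroup if there is a vector $x\ne0$ which lies in $\mathrm{dom}[T(t)T(s)]$ and satisfies $T(t)T(s)x=T(t+s)x$ for all $t,s\ge0$, and for which $T(\cdot)x$ is continuous on $(0,\infty)$ with $\lim_{t\to0^+}\|T(t)x-x\|=0$. For a conjugation $\mathcal C$, it is called $\mathcal C$-selfadjoint if every $T(t)$, $t\ge0$, is densely defined with $T(t)=\mathcal C\,T(t)^*\,\mathcal C$. Then $(W_{\xi,\zeta}(t))_{t\ge0}$ is a $\mathcal C_{a,b,c}$-selfadjoint unbounded $C_0$-semigroup if and only if the following two conditions hold. 1. $W_{\xi,\zeta}(t)=W_{\xi,\zeta}(t)_{\max}$ for every $t\ge0$. 2. There are functions $A,B,C,D:[0,\infty)\to\mathbb C$ with $\zeta_t(z)=A(t)z+B(t)$ and $\xi_t(z)=C(t)e^{D(t)z}$ for all $t\ge0$,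 $z\in\mathbb C$, such that either, for some $E,F\in\mathbb C$ and all $t\ge0$, $$A(t)=1,\quad B(t)=Et,\quad D(t)=aEt,\quad C(t)=\exp\left(Ft+\tfrac12aE^2t^2\right),$$ or, for some $\ell,G,H\in\mathbb C$ with $\ell\ne0$ and all $t\ge0$, $$A(t)=e^{\ell t},\quad B(t)=G(1-e^{\ell t}),\quad D(t)=(aG+b)(1-e^{\ell t}),\quad C(t)=\exp\left[Ht+G(aG+b)(e^{\ell t}-\ell t-1)\right].$$ (In the first form, $E=0$ occurs exactly when the semiflow is trivial, $\zeta_t(z)=z$ for all $t\ge 0$.) -/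

import Mathlib

open MeasureTheory Filter Topology ComplexConjugate

noncomputable section

/-- The complex linear space of entire functions that are square integrable for the Gaussian
measure `π⁻¹ exp (-|z|²) dV(z)`. -/
def fockSubmodule : Submodule ℂ (ℂ → ℂ) where
  carrier := {f | Differentiable ℂ f ∧
    Integrable (fun z : ℂ => ‖f z‖ ^ 2 * Real.exp (-‖z‖ ^ 2)) volume}
  zero_mem' := ⟨differentiable_const 0, by simp⟩
  add_mem' := by
    rintro f g ⟨hf, hf'⟩ ⟨hg, hg'⟩
    refine ⟨hf.add hg, ((hf'.add hg').const_mul 2).mono' ?_ (Eventually.of_forall fun z => ?_)⟩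
    · have h1 : Continuous fun z => (f + g) z := (hf.add hg).continuous
      apply Continuous.aestronglyMeasurable
      fun_prop
    · have h1 := norm_add_le (f z) (g z)
      have h2 : ‖f z + g z‖ ^ 2 ≤ 2 * (‖f z‖ ^ 2 + ‖g z‖ ^ 2) := by
        nlinarith [sq_nonneg (‖f z‖ - ‖g z‖), norm_nonneg (f z + g z)]
      have h3 := mul_le_mul_of_nonneg_right h2 (Real.exp_pos (-‖z‖ ^ 2)).le
      rw [Real.norm_of_nonneg (by positivity)]
      simp only [Pi.add_apply]
      linarith
  smul_mem' := by
    rintro c f ⟨hf, hf'⟩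
    refine ⟨hf.const_smul c, (hf'.const_mul (‖c‖ ^ 2)).congr (Eventually.of_forall fun z => ?_)⟩
    simp [mul_pow, mul_assoc]

/-- The Fock space `F²`. -/
def FockSpace : Type := fockSubmodule

namespace FockSpace

instance : AddCommGroup FockSpace := inferInstanceAs (AddCommGroup fockSubmodule)

instance : Module ℂ FockSpace := inferInstanceAs (Module ℂ fockSubmodule)

/-- The entire function underlying an element of the Fock space. -/
def toFun (f : FockSpace) : ℂ → ℂ := Subtype.val (p := (· ∈ fockSubmodule)) f

instance : CoeFun FockSpace fun _ => ℂ → ℂ := ⟨toFun⟩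

/-- The element of the Fock space given by a function in `fockSubmodule`. -/
def mk (f : ℂ → ℂ) (hf : f ∈ fockSubmodule) : FockSpace := ⟨f, hf⟩

@[simp] theorem mk_apply (f : ℂ → ℂ) (hf : f ∈ fockSubmodule) (z : ℂ) : mk f hf z = f z := rfl

@[simp] theorem add_apply (f g : FockSpace) (z : ℂ) : (f + g) z = f z + g z := rfl

@[simp] theorem smul_apply (c : ℂ) (f : FockSpace) (z : ℂ) : (c • f) z = c * f z := rfl

@[simp] theorem zero_apply (z : ℂ) : (0 : FockSpace) z = 0 := rfl

@[simp] theorem sub_apply (f g : FockSpace) (z : ℂ) : (f - g) z = f z - g z := rfl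

@[ext] theorem ext {f g : FockSpace} (h : ∀ z, f z = g z) : f = g := Subtype.ext (funext h)

theorem differentiable (f : FockSpace) : Differentiable ℂ (toFun f) := f.2.1

theorem continuous (f : FockSpace) : Continuous (toFun f) := f.differentiable.continuous

theorem integrable_sq (f : FockSpace) :
    Integrable (fun z : ℂ => ‖f z‖ ^ 2 * Real.exp (-‖z‖ ^ 2)) volume := f.2.2

theorem integrable_inner (f g : FockSpace) :
    Integrable (fun z : ℂ => conj (f z) * g z * (Real.exp (-‖z‖ ^ 2) : ℝ)) volume := by
  refine (f.integrable_sq.add g.integrable_sq).mono' ?_ (Eventually.of_forall fun z => ?_)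
  · have h1 := f.continuous
    have h2 := g.continuous
    have h3 : Continuous fun z => conj (f z) := Complex.continuous_conj.comp h1
    apply Continuous.aestronglyMeasurable
    fun_prop
  · have h2 : ‖f z‖ * ‖g z‖ ≤ ‖f z‖ ^ 2 + ‖g z‖ ^ 2 := by
      nlinarith [sq_nonneg (‖f z‖ - ‖g z‖), sq_nonneg (‖f z‖), sq_nonneg (‖g z‖)]
    have h3 := mul_le_mul_of_nonneg_right h2 (Real.exp_pos (-‖z‖ ^ 2)).le
    rw [norm_mul, norm_mul, Complex.norm_real, Real.norm_of_nonneg (Real.exp_pos _).le]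
    simp only [Pi.add_apply, RCLike.norm_conj]
    linarith

/-- The inner product of the Fock space, conjugate linear in the first argument as everywhere in
Mathlib. -/
def ip (f g : FockSpace) : ℂ :=
  (Real.pi : ℂ)⁻¹ * ∫ z : ℂ, conj (f z) * g z * (Real.exp (-‖z‖ ^ 2) : ℝ)

theorem ip_self (f : FockSpace) :
    ip f f = ((Real.pi⁻¹ * ∫ z : ℂ, ‖f z‖ ^ 2 * Real.exp (-‖z‖ ^ 2) : ℝ) : ℂ) := by
  have : ∀ z, conj (f z) * f z * (Real.exp (-‖z‖ ^ 2) : ℝ)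
      = ((‖f z‖ ^ 2 * Real.exp (-‖z‖ ^ 2) : ℝ) : ℂ) := fun z => by
    rw [Complex.conj_mul']; push_cast; rfl
  simp only [ip, this]
  rw [integral_complex_ofReal, Complex.ofReal_mul, Complex.ofReal_inv]

instance core : InnerProductSpace.Core ℂ FockSpace where
  inner := ip
  conj_inner_symm f g := by
    simp only [ip, map_mul, map_inv₀, Complex.conj_ofReal]
    rw [← integral_conj]
    congr 2
    ext z
    simp only [map_mul, Complex.conj_conj, Complex.conj_ofReal]
    ring
  re_inner_nonneg f := by
    rw [ip_self]
    simp only [RCLike.re_to_complex, Complex.ofReal_re]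
    have := Real.pi_pos
    positivity
  add_left f g h := by
    simp only [ip]
    rw [← mul_add, ← integral_add (integrable_inner f h) (integrable_inner g h)]
    congr 2
    ext z
    simp only [add_apply, map_add]
    ring
  smul_left f g r := by
    simp only [ip]
    rw [mul_left_comm, ← integral_const_mul (conj r)]
    congr 2
    funext z
    simp only [smul_apply, map_mul]
    ring
  definite f hf := by
    have hf : ip f f = 0 := hf
    rw [ip_self, Complex.ofReal_eq_zero, mul_eq_zero] at hf
    have h0 := hf.resolve_left (inv_ne_zero Real.pi_ne_zero)
    have hc : Continuous fun z : ℂ => ‖f z‖ ^ 2 * Real.exp (-‖z‖ ^ 2) := by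
      have := f.continuous
      fun_prop
    rw [integral_eq_zero_iff_of_nonneg (fun z => by positivity) f.integrable_sq] at h0
    have h1 := (Continuous.ae_eq_iff_eq volume hc continuous_const).1 h0
    ext z
    have := congrFun h1 z
    have h2 : ‖f z‖ ^ 2 * Real.exp (-‖z‖ ^ 2) = 0 := this
    simpa [Real.exp_ne_zero] using h2

instance : NormedAddCommGroup FockSpace := core.toNormedAddCommGroup

instance : InnerProductSpace ℂ FockSpace := InnerProductSpace.ofCore core.toCore

theorem inner_def (f g : FockSpace) :
    inner ℂ f g = (Real.pi : ℂ)⁻¹ * ∫ z : ℂ, conj (f z) * g z * (Real.exp (-‖z‖ ^ 2) : ℝ) := rfl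

theorem norm_sq (f : FockSpace) :
    ‖f‖ ^ 2 = Real.pi⁻¹ * ∫ z : ℂ, ‖f z‖ ^ 2 * Real.exp (-‖z‖ ^ 2) := by
  have h := inner_self_eq_norm_sq_to_K (𝕜 := ℂ) f
  have h2 : inner ℂ f f = ip f f := rfl
  rw [h2, ip_self] at h
  exact Complex.ofReal_injective (by rw [h]; exact Complex.ofReal_pow _ _)

end FockSpace

/-- Mean value property over a disc. -/
theorem setIntegral_closedBall_of_differentiable {f : ℂ → ℂ} (hf : Differentiable ℂ f) (z : ℂ) :
    ∫ w in Metric.closedBall (0 : ℂ) 1, f (z + w) = (Real.pi : ℂ) * f z := by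
  have hfc := hf.continuous
  have hrot : ∀ θ : ℝ, ∫ w in Metric.closedBall (0 : ℂ) 1, f (z + circleMap 0 1 θ * w)
      = ∫ w in Metric.closedBall (0 : ℂ) 1, f (z + w) := fun θ => by
    have h := (rotation (Circle.exp θ)).measurePreserving
    have hpre : (rotation (Circle.exp θ)) ⁻¹' Metric.closedBall (0 : ℂ) 1
        = Metric.closedBall (0 : ℂ) 1 := by
      ext w
      simp only [Set.mem_preimage, mem_closedBall_zero_iff, LinearIsometryEquiv.norm_map]
    have h2 := h.setIntegral_preimage_emb
      (rotation (Circle.exp θ)).toHomeomorph.measurableEmbedding (fun w => f (z + w))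
      (Metric.closedBall (0 : ℂ) 1)
    rw [hpre] at h2
    rw [← h2]
    simp [circleMap, Circle.coe_exp]
  have hmv : ∀ w : ℂ, ∫ θ in (0 : ℝ)..2 * Real.pi, f (z + circleMap 0 1 θ * w)
      = (2 * Real.pi : ℂ) * f z := fun w => by
    have hd : DiffContOnCl ℂ (fun u => f (z + u * w)) (Metric.ball 0 |1|) := by
      apply Differentiable.diffContOnCl
      fun_prop
    have h := hd.circleAverage
    simp only [Real.circleAverage_def, zero_mul, add_zero] at h
    rw [← h, Complex.real_smul]
    have hp : (Real.pi : ℂ) ≠ 0 := by exact_mod_cast Real.pi_ne_zero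
    push_cast
    rw [mul_inv_cancel_left₀ (mul_ne_zero two_ne_zero hp)]
  have hint : Integrable (Function.uncurry fun (w : ℂ) (θ : ℝ) => f (z + circleMap 0 1 θ * w))
      ((volume.restrict (Metric.closedBall (0 : ℂ) 1)).prod
        (volume.restrict (Set.Ioc 0 (2 * Real.pi)))) := by
    rw [Measure.prod_restrict]
    have hc : Continuous (Function.uncurry fun (w : ℂ) (θ : ℝ) => f (z + circleMap 0 1 θ * w)) := by
      have := continuous_circleMap 0 1
      unfold Function.uncurry
      fun_prop
    exact (hc.continuousOn.integrableOn_compact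
      ((isCompact_closedBall (0 : ℂ) 1).prod (isCompact_Icc (a := (0 : ℝ)) (b := 2 * Real.pi)))).mono_set
      (Set.prod_mono le_rfl Set.Ioc_subset_Icc_self)
  have hsw := integral_integral_swap hint
  have hpi : (0 : ℝ) ≤ 2 * Real.pi := by have := Real.pi_pos; positivity
  simp only [← intervalIntegral.integral_of_le hpi] at hsw
  simp only [hmv, hrot] at hsw
  rw [setIntegral_const, intervalIntegral.integral_const] at hsw
  have hv : volume.real (Metric.closedBall (0 : ℂ) 1) = Real.pi := by
    simp [Measure.real, Complex.volume_closedBall]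
  rw [hv] at hsw
  simp only [Complex.real_smul, sub_zero] at hsw
  have hp : (2 * Real.pi : ℂ) ≠ 0 := by
    simp
  apply mul_left_cancel₀ hp
  push_cast at hsw
  rw [← hsw]
  ring

namespace FockSpace

theorem sq_norm_apply_le (f : FockSpace) {R : ℝ} (z : ℂ) (hz : ‖z‖ ≤ R) :
    ‖f z‖ ^ 2 ≤ Real.exp ((R + 1) ^ 2) * ‖f‖ ^ 2 := by
  have hd : Differentiable ℂ fun z => f z ^ 2 := f.differentiable.pow 2
  have h := setIntegral_closedBall_of_differentiable hd z
  have hfc := f.continuous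
  have hpi := Real.pi_pos
  have h1 : Real.pi * ‖f z‖ ^ 2 ≤ ∫ w in Metric.closedBall (0 : ℂ) 1, ‖f (z + w)‖ ^ 2 := by
    calc Real.pi * ‖f z‖ ^ 2 = ‖(Real.pi : ℂ) * f z ^ 2‖ := by
          rw [norm_mul, norm_pow, Complex.norm_real, Real.norm_of_nonneg hpi.le]
      _ ≤ ∫ w in Metric.closedBall (0 : ℂ) 1, ‖f (z + w) ^ 2‖ := by
          rw [← h]; exact norm_integral_le_integral_norm _
      _ = _ := by simp only [norm_pow]
  have hg : Integrable (fun w : ℂ => Real.exp ((R + 1) ^ 2) *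
      (‖f (z + w)‖ ^ 2 * Real.exp (-‖z + w‖ ^ 2))) volume :=
    (f.integrable_sq.comp_add_left z).const_mul _
  have h2 : ∫ w in Metric.closedBall (0 : ℂ) 1, ‖f (z + w)‖ ^ 2 ≤
      ∫ w in Metric.closedBall (0 : ℂ) 1, Real.exp ((R + 1) ^ 2) *
        (‖f (z + w)‖ ^ 2 * Real.exp (-‖z + w‖ ^ 2)) := by
    apply setIntegral_mono_on _ hg.integrableOn Metric.isClosed_closedBall.measurableSet
    · intro w hw
      have hw' : ‖w‖ ≤ 1 := by simpa using hw
      have h3 : ‖z + w‖ ≤ R + 1 := (norm_add_le _ _).trans (by linarith)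
      have h4 : 1 ≤ Real.exp ((R + 1) ^ 2) * Real.exp (-‖z + w‖ ^ 2) := by
        rw [← Real.exp_add]
        apply Real.one_le_exp
        nlinarith [norm_nonneg (z + w)]
      nlinarith [sq_nonneg ‖f (z + w)‖]
    · apply ContinuousOn.integrableOn_compact (isCompact_closedBall _ _)
      apply Continuous.continuousOn
      fun_prop
  have h5 : ∫ w in Metric.closedBall (0 : ℂ) 1, Real.exp ((R + 1) ^ 2) *
        (‖f (z + w)‖ ^ 2 * Real.exp (-‖z + w‖ ^ 2)) ≤
      Real.exp ((R + 1) ^ 2) * (Real.pi * ‖f‖ ^ 2) := by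
    refine (setIntegral_le_integral hg (Eventually.of_forall fun w => by positivity)).trans ?_
    rw [integral_const_mul, norm_sq, mul_inv_cancel_left₀ hpi.ne']
    rw [integral_add_left_eq_self (fun w => ‖f w‖ ^ 2 * Real.exp (-‖w‖ ^ 2)) z]
  have h6 := h1.trans (h2.trans h5)
  have h7 : Real.pi * ‖f z‖ ^ 2 ≤ Real.pi * (Real.exp ((R + 1) ^ 2) * ‖f‖ ^ 2) := by
    linarith [h6]
  exact le_of_mul_le_mul_left h7 hpi

theorem norm_apply_le (f : FockSpace) {R : ℝ} (z : ℂ) (hz : ‖z‖ ≤ R) :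
    ‖f z‖ ≤ Real.exp ((R + 1) ^ 2) * ‖f‖ := by
  have h1 : 1 ≤ Real.exp ((R + 1) ^ 2) := Real.one_le_exp (sq_nonneg _)
  have h := f.sq_norm_apply_le z hz
  refine abs_le_of_sq_le_sq' ?_ (by positivity) |>.2
  rw [mul_pow]
  nlinarith [sq_nonneg ‖f‖]

theorem lintegral_eq (f : FockSpace) :
    ∫⁻ z : ℂ, ENNReal.ofReal (‖f z‖ ^ 2 * Real.exp (-‖z‖ ^ 2)) =
      ENNReal.ofReal (Real.pi * ‖f‖ ^ 2) := by
  rw [norm_sq, mul_inv_cancel_left₀ Real.pi_ne_zero,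
    ofReal_integral_eq_lintegral_ofReal f.integrable_sq (Eventually.of_forall fun z => by positivity)]

instance : CompleteSpace FockSpace := by
  refine Metric.complete_of_cauchySeq_tendsto fun u hu => ?_
  -- pointwise limits
  have hpt : ∀ R : ℝ, UniformCauchySeqOn (fun n z => u n z) atTop (Metric.closedBall (0 : ℂ) R) := by
    intro R
    rw [Metric.uniformCauchySeqOn_iff]
    intro ε hε
    have hE := Real.exp_pos ((R + 1) ^ 2)
    obtain ⟨N, hN⟩ := Metric.cauchySeq_iff.1 hu (ε / Real.exp ((R + 1) ^ 2)) (by positivity)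
    refine ⟨N, fun m hm n hn z hz => ?_⟩
    have h1 := (u m - u n).norm_apply_le z (R := R) (by simpa using hz)
    have h2 := hN m hm n hn
    rw [dist_eq_norm, lt_div_iff₀ hE] at h2
    rw [dist_eq_norm]
    rw [sub_apply] at h1
    linarith
  have hlim : ∀ z : ℂ, ∃ y, Tendsto (fun n => u n z) atTop (𝓝 y) := fun z =>
    cauchySeq_tendsto_of_complete ((hpt ‖z‖).cauchySeq (by simp))
  choose g hg using hlim
  have hgd : Differentiable ℂ g := by
    rw [← differentiableOn_univ]
    have : TendstoLocallyUniformlyOn (fun n z => u n z) g atTop Set.univ := by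
      rw [tendstoLocallyUniformlyOn_iff_forall_isCompact isOpen_univ]
      intro K _ hK
      obtain ⟨R, hR⟩ := hK.isBounded.subset_closedBall (0 : ℂ)
      exact ((hpt R).tendstoUniformlyOn_of_tendsto fun z _ => hg z).mono hR
    exact this.differentiableOn (Eventually.of_forall fun n => (u n).differentiable.differentiableOn)
      isOpen_univ
  -- Fatou estimate
  have hfatou : ∀ ε > 0, ∃ N, ∀ n ≥ N,
      ∫⁻ z : ℂ, ENNReal.ofReal (‖u n z - g z‖ ^ 2 * Real.exp (-‖z‖ ^ 2)) ≤
        ENNReal.ofReal (Real.pi * ε ^ 2) := by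
    intro ε hε
    obtain ⟨N, hN⟩ := Metric.cauchySeq_iff.1 hu ε hε
    refine ⟨N, fun n hn => ?_⟩
    have hmeas : ∀ m : ℕ, Measurable fun z : ℂ =>
        ENNReal.ofReal (‖(u n - u m) z‖ ^ 2 * Real.exp (-‖z‖ ^ 2)) := fun m => by
      have := (u n - u m).continuous.measurable
      fun_prop
    have h1 := lintegral_liminf_le (μ := (volume : Measure ℂ)) (u := atTop) hmeas
    have h2 : ∀ z : ℂ, liminf (fun m =>
        ENNReal.ofReal (‖(u n - u m) z‖ ^ 2 * Real.exp (-‖z‖ ^ 2))) atTop =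
        ENNReal.ofReal (‖u n z - g z‖ ^ 2 * Real.exp (-‖z‖ ^ 2)) := fun z => by
      apply Tendsto.liminf_eq
      simp only [sub_apply]
      apply ENNReal.tendsto_ofReal
      exact (((tendsto_const_nhds.sub (hg z)).norm.pow 2).mul_const _)
    simp only [h2, lintegral_eq] at h1
    refine h1.trans ?_
    refine liminf_le_of_frequently_le' (Eventually.frequently ?_)
    filter_upwards [eventually_ge_atTop N] with m hm
    have h3 := hN n hn m hm
    rw [dist_eq_norm] at h3
    apply ENNReal.ofReal_le_ofReal
    have := Real.pi_pos
    gcongr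
  have hmem : ∀ n, ∀ ε : ℝ, ∫⁻ z : ℂ, ENNReal.ofReal (‖u n z - g z‖ ^ 2 * Real.exp (-‖z‖ ^ 2)) ≤
        ENNReal.ofReal (Real.pi * ε ^ 2) → (fun z => u n z - g z) ∈ fockSubmodule := by
    intro n ε h
    refine ⟨(u n).differentiable.sub hgd, ?_, ?_⟩
    · have h1 := (u n).continuous
      have h2 := hgd.continuous
      apply Continuous.aestronglyMeasurable
      fun_prop
    · rw [hasFiniteIntegral_iff_ofReal (Eventually.of_forall fun z => by positivity)]
      exact h.trans_lt ENNReal.ofReal_lt_top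
  obtain ⟨N₁, hN₁⟩ := hfatou 1 one_pos
  have hgm : g ∈ fockSubmodule := by
    have h1 := hmem N₁ 1 (hN₁ N₁ le_rfl)
    have h2 := fockSubmodule.sub_mem (u N₁).2 h1
    have h3 : g = (u N₁).1 - fun z => u N₁ z - g z := by
      ext z
      change g z = u N₁ z - (u N₁ z - g z)
      ring
    rw [h3]
    exact h2
  refine ⟨mk g hgm, Metric.tendsto_atTop.2 fun ε hε => ?_⟩
  obtain ⟨N, hN⟩ := hfatou (ε / 2) (by positivity)
  refine ⟨N, fun n hn => ?_⟩
  have h1 := hN n hn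
  have h2 := lintegral_eq (u n - mk g hgm)
  simp only [sub_apply, mk_apply] at h2
  rw [h2, ENNReal.ofReal_le_ofReal_iff (by have := Real.pi_pos; positivity)] at h1
  have h3 := le_of_mul_le_mul_left h1 Real.pi_pos
  have h4 := abs_le_of_sq_le_sq' h3 (by positivity)
  rw [dist_eq_norm]
  linarith [h4.2]

end FockSpace

/-! ### Conjugations and unbounded `C`-selfadjoint operators -/

/-- A conjugation: an anti-linear, isometric involution. -/
structure Conjugation (H : Type*) [NormedAddCommGroup H] [InnerProductSpace ℂ H] where
  /-- the underlying anti-linear map -/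
  toMap : H →ₗ⋆[ℂ] H
  isometric : ∀ x, ‖toMap x‖ = ‖x‖
  involutive : ∀ x, toMap (toMap x) = x

section General

variable {H : Type*} [NormedAddCommGroup H] [InnerProductSpace ℂ H]

/-- The operator `C S C`, with its natural domain `{x | C x ∈ dom S}`. -/
def Conjugation.conjugate (C : Conjugation H) (S : H →ₗ.[ℂ] H) : H →ₗ.[ℂ] H where
  domain := S.domain.comap C.toMap
  toFun :=
    { toFun := fun x => C.toMap (S ⟨C.toMap x, x.2⟩)
      map_add' := fun x y => by
        rw [← map_add, ← S.map_add]
        congr 2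
        exact Subtype.ext (map_add C.toMap (x : H) y)
      map_smul' := fun r x => by
        have h : (⟨C.toMap ((r • x : S.domain.comap C.toMap) : H), (r • x).2⟩ : S.domain) =
            conj r • ⟨C.toMap (x : H), x.2⟩ :=
          Subtype.ext (C.toMap.map_smulₛₗ r (x : H))
        rw [h, S.map_smul, C.toMap.map_smulₛₗ, Complex.conj_conj, RingHom.id_apply] }

/-- A densely defined operator `S` is `C`-selfadjoint if `S = C S* C`. -/
def IsCSelfadjoint [CompleteSpace H] (C : Conjugation H) (S : H →ₗ.[ℂ] H) : Prop :=
  Dense (S.domain : Set H) ∧ S = C.conjugate S.adjoint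

/-- The intersection of the domains of all the products `T(t) T(s)` with `t, s ≥ 0`, where
`dom (T(t) T(s)) = {x ∈ dom T(s) | T(s) x ∈ dom T(t)}`. -/
def productDomain (T : ℝ → H →ₗ.[ℂ] H) : Set H :=
  {x | ∀ t s : ℝ, 0 ≤ t → 0 ≤ s → ∃ hx : x ∈ (T s).domain, T s ⟨x, hx⟩ ∈ (T t).domain}

/-- A nonzero vector `x` on which the family `(T(t))`, `t ≥ 0`, of unbounded operators has the
semigroup property and is strongly continuous; the values of `T` at negative times are irrelevant. -/
structure IsSemigroupVector (T : ℝ → H →ₗ.[ℂ] H) (x : H) : Prop where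
  ne_zero : x ≠ 0
  mem_productDomain : x ∈ productDomain T
  /-- `T(t) T(s) x = T(t + s) x` -/
  semigroup : ∀ t s : ℝ, 0 ≤ t → 0 ≤ s → ∀ (h₁ : x ∈ (T s).domain)
    (h₂ : T s ⟨x, h₁⟩ ∈ (T t).domain) (h₃ : x ∈ (T (t + s)).domain),
      T t ⟨T s ⟨x, h₁⟩, h₂⟩ = T (t + s) ⟨x, h₃⟩
  /-- the orbit `u(t) = T(t) x` is continuous on `(0, ∞)` and tends to `x` at `0` -/
  continuous : ∃ u : ℝ → H, (∀ t : ℝ, 0 ≤ t → ∃ h : x ∈ (T t).domain, T t ⟨x, h⟩ = u t) ∧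
    ContinuousOn u (Set.Ioi 0) ∧ Tendsto (fun t => ‖u t - x‖) (𝓝[>] 0) (𝓝 0)

/-- A family `(T(t))`, `t ≥ 0`, of unbounded linear operators is an unbounded `C₀`-semigroup if some
nonzero vector has the semigroup property and a continuous orbit. -/
def IsUnboundedC0Semigroup (T : ℝ → H →ₗ.[ℂ] H) : Prop := ∃ x, IsSemigroupVector T x

/-- An unbounded `C₀`-semigroup is `C`-selfadjoint if each of its operators is. -/
def IsCSelfadjointUnboundedC0Semigroup [CompleteSpace H] (C : Conjugation H)
    (T : ℝ → H →ₗ.[ℂ] H) : Prop :=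
  IsUnboundedC0Semigroup T ∧ ∀ t : ℝ, 0 ≤ t → IsCSelfadjoint C (T t)

end General

/-! ### Weighted composition conjugations -/

namespace FockSpace

/-- The conditions on the parameters `a, b, c` of a weighted composition conjugation. -/
structure IsConjugationParam (a b c : ℂ) : Prop where
  norm_a : ‖a‖ = 1
  rel : conj a * b + conj b = 0
  norm_c : ‖c‖ ^ 2 * Real.exp (‖b‖ ^ 2) = 1

/-- The expression `c e^{bz} conj (f (conj (az + b)))`. -/
def conjExpr (a b c : ℂ) (f : ℂ → ℂ) (z : ℂ) : ℂ :=
  c * Complex.exp (b * z) * conj (f (conj (a * z + b)))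

variable {a b c : ℂ}

theorem measurePreserving_conj_affine (ha : ‖a‖ = 1) (b : ℂ) :
    MeasurePreserving (fun z : ℂ => conj (a * z + b)) volume volume := by
  have h1 := (rotation ⟨a, by simpa [Submonoid.unitSphere] using ha⟩).measurePreserving
  have h2 := measurePreserving_add_right (volume : Measure ℂ) b
  have h3 := Complex.conjLIE.measurePreserving
  exact h3.comp (h2.comp h1)

theorem measurableEmbedding_conj_affine (ha : ‖a‖ = 1) (b : ℂ) :
    MeasurableEmbedding (fun z : ℂ => conj (a * z + b)) := by
  have h1 := (rotation ⟨a, by simpa [Submonoid.unitSphere] using ha⟩).toHomeomorph.measurableEmbedding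
  have h2 := (Homeomorph.addRight b).measurableEmbedding
  have h3 := Complex.conjLIE.toHomeomorph.measurableEmbedding
  exact h3.comp (h2.comp h1)

theorem conjExpr_weight (h : IsConjugationParam a b c) (f : ℂ → ℂ) (z : ℂ) :
    ‖conjExpr a b c f z‖ ^ 2 * Real.exp (-‖z‖ ^ 2) =
      ‖f (conj (a * z + b))‖ ^ 2 * Real.exp (-‖conj (a * z + b)‖ ^ 2) := by
  have haa : conj a * a = 1 := by rw [Complex.conj_mul', h.norm_a]; simp
  have hexp : ‖z‖ ^ 2 + ‖b‖ ^ 2 = ‖conj (a * z + b)‖ ^ 2 + 2 * (b * z).re := by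
    apply Complex.ofReal_injective
    have e : (((b * z).re : ℝ) : ℂ) = (b * z + conj (b * z)) / 2 := Complex.re_eq_add_conj _
    push_cast
    rw [e, ← Complex.conj_mul', ← Complex.conj_mul', ← Complex.conj_mul']
    have hr := h.rel
    have hr' : a * conj b + b = 0 := by
      have := congrArg conj hr
      simpa using this
    simp only [map_add, map_mul, Complex.conj_conj]
    linear_combination (-conj z * z) * haa - conj z * hr - z * hr'
  have hc := h.norm_c
  simp only [conjExpr, norm_mul, RCLike.norm_conj, Complex.norm_exp] at *
  have hk : Real.exp (b * z).re ^ 2 * Real.exp (-‖z‖ ^ 2) =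
      Real.exp (‖b‖ ^ 2) * Real.exp (-‖a * z + b‖ ^ 2) := by
    rw [← Real.exp_nat_mul, ← Real.exp_add, ← Real.exp_add]
    congr 1
    push_cast
    linarith
  calc _ = ‖c‖ ^ 2 * ‖f (conj (a * z + b))‖ ^ 2 *
        (Real.exp (b * z).re ^ 2 * Real.exp (-‖z‖ ^ 2)) := by ring
    _ = (‖c‖ ^ 2 * Real.exp (‖b‖ ^ 2)) *
        (‖f (conj (a * z + b))‖ ^ 2 * Real.exp (-‖a * z + b‖ ^ 2)) := by rw [hk]; ring
    _ = _ := by rw [hc, one_mul]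

theorem conjExpr_mem (h : IsConjugationParam a b c) (f : FockSpace) :
    conjExpr a b c f ∈ fockSubmodule := by
  constructor
  · have h1 : Differentiable ℂ (conj ∘ toFun f ∘ conj) := fun z => by
      have := (f.differentiable (conj z)).conj_conj
      rwa [Complex.conj_conj] at this
    have h2 : Differentiable ℂ fun z : ℂ => (conj ∘ toFun f ∘ conj) (a * z + b) :=
      h1.comp (by fun_prop)
    exact (show Differentiable ℂ fun z : ℂ => c * Complex.exp (b * z) by fun_prop).mul h2
  · simp only [conjExpr_weight h]
    exact (measurePreserving_conj_affine h.norm_a b).integrable_comp_of_integrable f.integrable_sq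

/-- The weighted composition conjugation `C_{a,b,c} f (z) = c e^{bz} conj (f (conj (az + b)))`. -/
def conjugation (a b c : ℂ) (h : IsConjugationParam a b c) : Conjugation FockSpace where
  toMap :=
    { toFun := fun f => mk (conjExpr a b c f) (conjExpr_mem h f)
      map_add' := fun f g => by
        ext z
        simp only [mk_apply, add_apply, conjExpr, map_add]
        ring
      map_smul' := fun r f => by
        ext z
        simp only [mk_apply, smul_apply, conjExpr, map_mul]
        ring }
  isometric f := by
    have h1 : ‖mk (conjExpr a b c f) (conjExpr_mem h f)‖ ^ 2 = ‖f‖ ^ 2 := by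
      rw [norm_sq, norm_sq]
      congr 1
      simp only [mk_apply, conjExpr_weight h]
      exact (measurePreserving_conj_affine h.norm_a b).integral_comp
        (measurableEmbedding_conj_affine h.norm_a b)
        (fun z => ‖f z‖ ^ 2 * Real.exp (-‖z‖ ^ 2))
    exact (sq_eq_sq₀ (norm_nonneg _) (norm_nonneg _)).1 h1
  involutive f := by
    have haa : conj a * a = 1 := by rw [Complex.conj_mul', h.norm_a]; simp
    have hr := h.rel
    have hr' : a * conj b + b = 0 := by
      have := congrArg conj hr
      simpa using this
    ext z
    have hw : conj (a * conj (a * z + b) + b) = z := by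
      simp only [map_add, map_mul, Complex.conj_conj]
      linear_combination z * haa + hr
    have he : b * z + conj b * (a * z + b) = ((‖b‖ ^ 2 : ℝ) : ℂ) := by
      push_cast
      rw [← Complex.conj_mul']
      linear_combination z * hr'
    have hcc : c * conj c * Complex.exp ((‖b‖ ^ 2 : ℝ) : ℂ) = 1 := by
      rw [Complex.mul_conj', ← Complex.ofReal_exp]
      exact_mod_cast h.norm_c
    change conjExpr a b c (conjExpr a b c f) z = f z
    simp only [conjExpr]
    rw [hw]
    simp only [map_mul, Complex.conj_conj, ← Complex.exp_conj]
    rw [← he, Complex.exp_add] at hcc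
    linear_combination f z * hcc

/-! ### Weighted composition operators -/

/-- The maximal weighted composition operator `f ↦ ψ · f ∘ φ`, whose domain consists of all `f` in
the Fock space for which `ψ · f ∘ φ` is in the Fock space. -/
def maxWCO (ψ φ : ℂ → ℂ) : FockSpace →ₗ.[ℂ] FockSpace where
  domain :=
    { carrier := {f | (fun z => ψ z * f (φ z)) ∈ fockSubmodule}
      zero_mem' := by
        have h : (fun z => ψ z * (0 : FockSpace) (φ z)) = 0 := by ext z; simp
        change (fun z => ψ z * (0 : FockSpace) (φ z)) ∈ fockSubmodule
        rw [h]
        exact zero_mem _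
      add_mem' := fun {f g} hf hg => by
        have h : (fun z => ψ z * (f + g) (φ z)) =
            (fun z => ψ z * f (φ z)) + fun z => ψ z * g (φ z) := by
          ext z; simp [mul_add]
        change (fun z => ψ z * (f + g) (φ z)) ∈ fockSubmodule
        rw [h]
        exact add_mem hf hg
      smul_mem' := fun r f hf => by
        have h : (fun z => ψ z * (r • f) (φ z)) = r • fun z => ψ z * f (φ z) := by
          ext z; simp [mul_left_comm]
        change (fun z => ψ z * (r • f) (φ z)) ∈ fockSubmodule
        rw [h]
        exact fockSubmodule.smul_mem r hf }
  toFun :=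
    { toFun := fun f => mk (fun z => ψ z * (f : FockSpace) (φ z)) f.2
      map_add' := fun f g => by ext z; simp [mul_add]
      map_smul' := fun r f => by ext z; simp [mul_left_comm] }

/-- `W` is an unbounded weighted composition operator with symbols `ψ, φ`: a restriction of the
maximal one to some linear subspace of the maximal domain. -/
def IsWCO (W : FockSpace →ₗ.[ℂ] FockSpace) (ψ φ : ℂ → ℂ) : Prop := W ≤ maxWCO ψ φ

end FockSpace

/-! ### Semiflows and semicocycles -/

/-- A semiflow `(ζ_t)`, `t ≥ 0`, of nonconstant entire functions, continuous in `t`. -/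
structure IsSemiflow (ζ : ℝ → ℂ → ℂ) : Prop where
  entire : ∀ t : ℝ, 0 ≤ t → Differentiable ℂ (ζ t)
  nonconstant : ∀ t : ℝ, 0 ≤ t → ¬ ∃ k : ℂ, ∀ z, ζ t z = k
  zero : ∀ z, ζ 0 z = z
  add : ∀ t s : ℝ, 0 ≤ t → 0 ≤ s → ∀ z, ζ (t + s) z = ζ t (ζ s z)
  continuous : ∀ z, ContinuousOn (fun t => ζ t z) (Set.Ici 0)

/-- A semicocycle `(ξ_t)`, `t ≥ 0`, for the semiflow `(ζ_t)`. -/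
structure IsSemicocycle (ζ ξ : ℝ → ℂ → ℂ) : Prop where
  entire : ∀ t : ℝ, 0 ≤ t → Differentiable ℂ (ξ t)
  differentiable : ∀ z, DifferentiableOn ℝ (fun t => ξ t z) (Set.Ici 0)
  add : ∀ t s : ℝ, 0 ≤ t → 0 ≤ s → ∀ z, ξ (t + s) z = ξ t z * ξ s (ζ t z)
  zero : ∀ z, ξ 0 z = 1

/-- The family `(W(t))`, `t ≥ 0`, is a weighted composition semigroup induced by `(ζ_t)` and
`(ξ_t)`: each `W(t)` is an unbounded weighted composition operator with symbols `ξ_t, ζ_t`. -/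
def IsWCSemigroup (W : ℝ → FockSpace →ₗ.[ℂ] FockSpace) (ξ ζ : ℝ → ℂ → ℂ) : Prop :=
  ∀ t : ℝ, 0 ≤ t → FockSpace.IsWCO (W t) (ξ t) (ζ t)

/-- The translation type of coefficient functions. -/
def IsTranslationType (a : ℂ) (A B C D : ℝ → ℂ) : Prop :=
  ∃ E F : ℂ, ∀ t : ℝ, 0 ≤ t →
    A t = 1 ∧ B t = E * t ∧ D t = a * E * t ∧
    C t = Complex.exp (F * t + a * E ^ 2 * t ^ 2 / 2)

/-- The affine-exponential type of coefficient functions. -/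
def IsAffineExponentialType (a b : ℂ) (A B C D : ℝ → ℂ) : Prop :=
  ∃ l G K : ℂ, l ≠ 0 ∧ ∀ t : ℝ, 0 ≤ t →
    A t = Complex.exp (l * t) ∧ B t = G * (1 - Complex.exp (l * t)) ∧
    D t = (a * G + b) * (1 - Complex.exp (l * t)) ∧
    C t = Complex.exp (K * t + G * (a * G + b) * (Complex.exp (l * t) - l * t - 1))

end

/-! Write `J` for the conjugation and `K_w(z) = exp(conj w * z)` for the reproducing kernel. The
adjoint of a densely defined weighted composition operator `W` with symbols `ψ, φ` sends `K_w` to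
`conj (ψ w) • K_{φ w}`. If `W = J W* J`, then `J K_w` lies in the domain of `W`, and computing `W (J
K_w)` at `z` in two ways gives an equation symmetric in `z` and `w` (`symbol_equation`). Its case `w
= 0` eliminates `ψ`. What remains says that an exponent built from `φ` always lies in `2πiℤ`, so by
continuity it vanishes. Hence `φ(z) = Az + B` and `ψ(z) = C e^{Dz}` with `D = aB + b(1 - A)`
(`affine_of_symbol_equation`). The semiflow and semicocycle laws then become functional equations in
time, solved in `coefficient_types`; the two types are `A = 1` identically and `A = e^{lt}` with `l
≠ 0`.

The analytic core is `inner_affineWC`: with affine symbols, the weighted composition and its formal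
adjoint, which has coefficients `conj A, conj D, conj C, conj B`, are adjoint to each other on their
full maximal domains. For `‖A‖ < 1` the operator is bounded and kernels suffice; for `‖A‖ = 1` the
symbol is dilated by `r < 1` and a weak limit is taken; for `‖A‖ > 1` both operators are inverted.

The relation between `D` and `A, B` makes `J` intertwine the two. So the maximal operator is
`J`-selfadjoint, and a `J`-selfadjoint restriction `W` satisfies `W ≤ max ≤ J W* J = W`, which
forces maximality. In the converse direction the constant function `K_0` is a semigroup vector,
because its orbit is an explicit continuous family of multiples of kernels. -/

/-! ### The reproducing kernel and weak convergence in the Fock space. -/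

/-- Mean value property with respect to the Gaussian measure. -/
theorem integral_mul_gaussian_of_differentiable {h : ℂ → ℂ} (hd : Differentiable ℂ h)
    (hi : Integrable (fun z : ℂ => h z * (Real.exp (-‖z‖ ^ 2) : ℝ)) volume) :
    ∫ z : ℂ, h z * (Real.exp (-‖z‖ ^ 2) : ℝ) = (Real.pi : ℂ) * h 0 := by
  have hc := hd.continuous
  have hpi := Real.pi_pos
  have hrotI : ∀ θ : ℝ, Integrable
      (fun z : ℂ => h (circleMap 0 1 θ * z) * (Real.exp (-‖z‖ ^ 2) : ℝ)) volume := fun θ => by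
    have h1 := ((rotation (Circle.exp θ)).measurePreserving).integrable_comp_of_integrable hi
    simpa [Function.comp_def, circleMap, Circle.coe_exp] using h1
  have hrot : ∀ θ : ℝ, ∫ z : ℂ, h (circleMap 0 1 θ * z) * (Real.exp (-‖z‖ ^ 2) : ℝ)
      = ∫ z : ℂ, h z * (Real.exp (-‖z‖ ^ 2) : ℝ) := fun θ => by
    have h1 := ((rotation (Circle.exp θ)).measurePreserving).integral_comp
      (rotation (Circle.exp θ)).toHomeomorph.measurableEmbedding
      (fun z : ℂ => h z * (Real.exp (-‖z‖ ^ 2) : ℝ))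
    simpa [circleMap, Circle.coe_exp] using h1
  have hrotN : ∀ θ : ℝ, ∫ z : ℂ, ‖h (circleMap 0 1 θ * z) * (Real.exp (-‖z‖ ^ 2) : ℝ)‖
      = ∫ z : ℂ, ‖h z * (Real.exp (-‖z‖ ^ 2) : ℝ)‖ := fun θ => by
    have h1 := ((rotation (Circle.exp θ)).measurePreserving).integral_comp
      (rotation (Circle.exp θ)).toHomeomorph.measurableEmbedding
      (fun z : ℂ => ‖h z * (Real.exp (-‖z‖ ^ 2) : ℝ)‖)
    simpa [circleMap, Circle.coe_exp] using h1
  have hmv : ∀ w : ℂ, ∫ θ in (0 : ℝ)..2 * Real.pi, h (circleMap 0 1 θ * w)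
      = (2 * Real.pi : ℂ) * h 0 := fun w => by
    have hdc : DiffContOnCl ℂ (fun u => h (u * w)) (Metric.ball 0 |1|) := by
      apply Differentiable.diffContOnCl
      fun_prop
    have h1 := hdc.circleAverage
    simp only [Real.circleAverage_def, zero_mul] at h1
    rw [← h1, Complex.real_smul]
    have hp : (Real.pi : ℂ) ≠ 0 := by exact_mod_cast Real.pi_ne_zero
    push_cast
    rw [mul_inv_cancel_left₀ (mul_ne_zero two_ne_zero hp)]
  have hint : Integrable (Function.uncurry fun (θ : ℝ) (z : ℂ) =>
      h (circleMap 0 1 θ * z) * (Real.exp (-‖z‖ ^ 2) : ℝ))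
      ((volume.restrict (Set.Ioc 0 (2 * Real.pi))).prod volume) := by
    have hcont : Continuous (Function.uncurry fun (θ : ℝ) (z : ℂ) =>
        h (circleMap 0 1 θ * z) * (Real.exp (-‖z‖ ^ 2) : ℝ)) := by
      have := continuous_circleMap 0 1
      unfold Function.uncurry
      fun_prop
    -- Each slice is a rotation of the integrable function `hi`, and by `hrotN` the slices all have
    -- the same `L¹` norm.
    rw [integrable_prod_iff hcont.aestronglyMeasurable]
    refine ⟨Eventually.of_forall fun θ => hrotI θ, ?_⟩
    simp only [Function.uncurry, hrotN]
    exact integrable_const _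
  -- Integrating over `z` first gives the Gaussian integral of `h` for every angle; integrating over
  -- the angle first gives `2π * h 0` for every `z`.
  have hsw := integral_integral_swap hint
  have h2pi : (0 : ℝ) ≤ 2 * Real.pi := by positivity
  simp only [← intervalIntegral.integral_of_le h2pi, hrot] at hsw
  simp only [intervalIntegral.integral_mul_const, hmv] at hsw
  rw [integral_const_mul, intervalIntegral.integral_const, integral_complex_ofReal] at hsw
  have hG : ∫ v : ℂ, Real.exp (-‖v‖ ^ 2) = Real.pi := by
    have := GaussianFourier.integral_rexp_neg_mul_sq_norm (V := ℂ) one_pos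
    simpa using this
  rw [hG] at hsw
  have hp : (2 * Real.pi : ℂ) ≠ 0 := by simp
  apply mul_left_cancel₀ hp
  simp only [Complex.real_smul, sub_zero] at hsw
  rw [Complex.ofReal_mul, Complex.ofReal_ofNat] at hsw
  rw [hsw]
  ring

namespace FockSpace

theorem exp_mem (w : ℂ) : (fun z => Complex.exp (conj w * z)) ∈ fockSubmodule := by
  refine ⟨by fun_prop, ?_⟩
  have h := (GaussianFourier.integrable_cexp_neg_mul_sq_norm_add (V := ℂ) (b := 1)
    (by simp) 2 w).norm
  refine h.congr (Eventually.of_forall fun z => ?_)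
  simp only [Complex.norm_exp]
  rw [← Real.exp_nat_mul, ← Real.exp_add]
  congr 1
  simp [Complex.inner, ← Complex.ofReal_pow]
  ring

/-- The reproducing kernel of the Fock space. -/
noncomputable def kernel (w : ℂ) : FockSpace := mk (fun z => Complex.exp (conj w * z)) (exp_mem w)

theorem kernel_apply (w z : ℂ) : kernel w z = Complex.exp (conj w * z) := rfl

/-- Translating the variable by `w` absorbs the conjugated kernel into the recentred Gaussian and
leaves the entire function `exp(-conj w * v) * f(v + w)`, whose Gaussian mean is its value at `v =
0`. -/
theorem inner_kernel (w : ℂ) (f : FockSpace) : inner ℂ (kernel w) f = f w := by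
  have hi := integrable_inner (kernel w) f
  have key : ∀ v : ℂ, conj (kernel w (v + w)) * f (v + w) * (Real.exp (-‖v + w‖ ^ 2) : ℝ)
      = Complex.exp (-(conj w * v)) * f (v + w) * (Real.exp (-‖v‖ ^ 2) : ℝ) := fun v => by
    have : conj (kernel w (v + w)) * (Real.exp (-‖v + w‖ ^ 2) : ℝ) =
        Complex.exp (-(conj w * v)) * (Real.exp (-‖v‖ ^ 2) : ℝ) := by
      rw [kernel_apply, ← Complex.exp_conj]
      push_cast
      rw [← Complex.exp_add, ← Complex.exp_add, ← Complex.conj_mul', ← Complex.conj_mul']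
      congr 1
      simp only [map_mul, map_add, Complex.conj_conj]
      ring
    linear_combination f (v + w) * this
  rw [inner_def, ← integral_add_right_eq_self _ w]
  have hi2 := hi.comp_add_right w
  simp only [key] at hi2 ⊢
  have hd : Differentiable ℂ fun v => Complex.exp (-(conj w * v)) * f (v + w) := by
    have := f.differentiable
    have h2 : Differentiable ℂ fun v => f (v + w) := this.comp (by fun_prop)
    exact Differentiable.mul (by fun_prop) h2
  rw [integral_mul_gaussian_of_differentiable hd hi2]
  simp

/-- A function orthogonal to every kernel vanishes at every point. -/
theorem dense_of_kernel_mem (p : Submodule ℂ FockSpace) (hp : ∀ w, kernel w ∈ p) :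
    Dense (p : Set FockSpace) := by
  rw [Submodule.dense_iff_topologicalClosure_eq_top, Submodule.topologicalClosure_eq_top_iff,
    Submodule.eq_bot_iff]
  intro f hf
  ext w
  rw [← inner_kernel]
  exact (Submodule.mem_orthogonal p f).1 hf _ (hp w)

/-- A bounded family in the Fock space that converges pointwise converges weakly. -/
theorem tendsto_inner_of_bounded {ι : Type*} {l : Filter ι} {u : ι → FockSpace} {f : FockSpace}
    {M : ℝ} (hM : ∀ᶠ i in l, ‖u i‖ ≤ M) (hp : ∀ z, Tendsto (fun i => u i z) l (𝓝 (f z)))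
    (g : FockSpace) : Tendsto (fun i => inner ℂ g (u i)) l (𝓝 (inner ℂ g f)) := by
  set p : Submodule ℂ FockSpace := Submodule.span ℂ (Set.range kernel) with hpdef
  have hdense : Dense (p : Set FockSpace) :=
    dense_of_kernel_mem p fun w => Submodule.subset_span ⟨w, rfl⟩
  have hspan : ∀ g ∈ p, Tendsto (fun i => inner ℂ g (u i)) l (𝓝 (inner ℂ g f)) := by
    intro g hg
    induction hg using Submodule.span_induction with
    | mem x hx =>
      obtain ⟨w, rfl⟩ := hx
      simpa only [inner_kernel] using hp w
    | zero => simpa only [inner_zero_left] using tendsto_const_nhds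
    | add x y _ _ hx hy => simpa only [inner_add_left] using hx.add hy
    | smul r x _ hx => simpa only [inner_smul_left] using hx.const_mul _
  rw [Metric.tendsto_nhds]
  intro ε hε
  -- `K` dominates `‖u i - f‖`; the summand 1 keeps it positive, so that it can be divided by.
  set K := max M 0 + ‖f‖ + 1 with hK
  have hKpos : 0 < K := by positivity
  obtain ⟨g', hg', hgg'⟩ := Metric.mem_closure_iff.1 (hdense g) (ε / (2 * K)) (by positivity)
  filter_upwards [hM, (Metric.tendsto_nhds.1 (hspan g' hg')) (ε / 2) (by positivity)] with i h1 h2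
  rw [dist_eq_norm] at hgg' h2 ⊢
  have e : inner ℂ g (u i) - inner ℂ g f =
      inner ℂ (g - g') (u i - f) + (inner ℂ g' (u i) - inner ℂ g' f) := by
    simp only [inner_sub_left, inner_sub_right]
    ring
  have h3 : ‖inner ℂ (g - g') (u i - f)‖ ≤ ε / (2 * K) * K := by
    refine (norm_inner_le_norm _ _).trans (mul_le_mul hgg'.le ?_ (norm_nonneg _) (by positivity))
    have := norm_sub_le (u i) f
    have := le_max_left M 0
    linarith
  have h4 : ε / (2 * K) * K = ε / 2 := by field_simp
  rw [e]
  refine (norm_add_le _ _).trans_lt ?_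
  linarith

/-- By the reproducing property the squared distance of two kernels is a combination of kernel
values. This yields norm continuity of the orbit of the semigroup vector. -/
theorem continuous_kernel : Continuous kernel := by
  rw [continuous_iff_continuousAt]
  intro w
  rw [ContinuousAt, tendsto_iff_norm_sub_tendsto_zero]
  have h : ∀ v, ‖kernel v - kernel w‖ ^ 2 =
      (kernel v v - kernel v w - kernel w v + kernel w w).re := fun v => by
    rw [← inner_self_eq_norm_sq (𝕜 := ℂ)]
    simp only [inner_sub_left, inner_sub_right, inner_kernel]
    simp only [RCLike.re_to_complex, Complex.sub_re, Complex.add_re]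
    ring
  have hc : Continuous fun v => (kernel v v - kernel v w - kernel w v + kernel w w).re := by
    simp only [kernel_apply]
    have := Complex.continuous_conj
    fun_prop
  have ht : Tendsto (fun v => ‖kernel v - kernel w‖ ^ 2) (𝓝 w) (𝓝 0) := by
    simp only [h]
    have := hc.tendsto w
    simpa using this
  have := ht.sqrt
  simpa [Real.sqrt_sq] using this

end FockSpace

/-! ### Weighted compositions with affine symbols and their adjoints. -/

theorem integrable_comp_affine {A : ℂ} (hA : A ≠ 0) (B : ℂ) {h : ℂ → ℝ} (hh : Integrable h) :
    Integrable (fun z => h (A * z + B)) := by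
  have hA' : ‖A‖ ≠ 0 := norm_ne_zero_iff.2 hA
  have hu : ‖A / ‖A‖‖ = 1 := by simp [hA']
  have h1 := (rotation ⟨A / ‖A‖, by
    simpa [Submonoid.unitSphere] using hu⟩).measurePreserving.integrable_comp_of_integrable
      (hh.comp_add_right B)
  have h2 := h1.comp_smul hA'
  refine h2.congr (Eventually.of_forall fun z => ?_)
  have hA2 : (‖A‖ : ℂ) ≠ 0 := by exact_mod_cast hA'
  simp only [Function.comp_apply, Complex.real_smul]
  congr 2
  change A / ‖A‖ * (‖A‖ * z) = A * z
  field_simp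

/-- The affine map is a dilation by `‖A‖`, a rotation by `A / ‖A‖` and a translation, so its real
Jacobian is `‖A‖ ^ 2`. -/
theorem integral_comp_affine {A : ℂ} (hA : A ≠ 0) (B : ℂ) (h : ℂ → ℝ) :
    ∫ z, h (A * z + B) = (‖A‖ ^ 2)⁻¹ * ∫ z, h z := by
  have hA' : ‖A‖ ≠ 0 := norm_ne_zero_iff.2 hA
  have hu : ‖A / ‖A‖‖ = 1 := by simp [hA']
  set e := rotation ⟨A / ‖A‖, by simpa [Submonoid.unitSphere] using hu⟩ with he
  have h1 := e.measurePreserving.integral_comp e.toHomeomorph.measurableEmbedding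
    (fun z => h (z + B))
  have h2 := Measure.integral_comp_smul_of_nonneg (volume : Measure ℂ) (fun z => h (e z + B)) ‖A‖
    (hR := norm_nonneg A)
  rw [h1, integral_add_right_eq_self h B, Complex.finrank_real_complex, smul_eq_mul] at h2
  rw [← h2]
  congr 1
  ext z
  have hA2 : (‖A‖ : ℂ) ≠ 0 := by exact_mod_cast hA'
  simp only [Complex.real_smul]
  congr 2
  change A * z = A / ‖A‖ * (‖A‖ * z)
  field_simp

namespace FockSpace

/-- `f'` is the weighted composition `C e^{Dz} f(Az + B)` of `f`. -/
def IsAffineWC (A B C D : ℂ) (f f' : FockSpace) : Prop :=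
  ∀ z, f' z = C * Complex.exp (D * z) * f (A * z + B)

theorem mem_of_weight_le {F : ℂ → ℂ} (hF : Differentiable ℂ F) (f : FockSpace) {A : ℂ} (hA : A ≠ 0)
    (B : ℂ) {M : ℝ} (hM : ∀ z, ‖F z‖ ^ 2 * Real.exp (-‖z‖ ^ 2) ≤
      M * (‖f (A * z + B)‖ ^ 2 * Real.exp (-‖A * z + B‖ ^ 2))) : F ∈ fockSubmodule := by
  refine ⟨hF, ((integrable_comp_affine hA B f.integrable_sq).const_mul M).mono' ?_
    (Eventually.of_forall fun z => ?_)⟩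
  · have := hF.continuous
    apply Continuous.aestronglyMeasurable
    fun_prop
  · rw [Real.norm_of_nonneg (by positivity)]
    exact hM z

theorem norm_sq_le_of_weight_le (g f : FockSpace) {A : ℂ} (hA : A ≠ 0)
    (B : ℂ) {M : ℝ} (hM : ∀ z, ‖g z‖ ^ 2 * Real.exp (-‖z‖ ^ 2) ≤
      M * (‖f (A * z + B)‖ ^ 2 * Real.exp (-‖A * z + B‖ ^ 2))) :
    ‖g‖ ^ 2 ≤ M * (‖A‖ ^ 2)⁻¹ * ‖f‖ ^ 2 := by
  have hpi := Real.pi_pos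
  have h1 := integral_mono g.integrable_sq
    ((integrable_comp_affine hA B f.integrable_sq).const_mul M) hM
  rw [integral_const_mul,
    integral_comp_affine hA B (fun z => ‖f z‖ ^ 2 * Real.exp (-‖z‖ ^ 2))] at h1
  rw [norm_sq g, norm_sq f]
  calc _ ≤ Real.pi⁻¹ * _ := mul_le_mul_of_nonneg_left h1 (by positivity)
    _ = _ := by ring

/-- A bound for the symbol of a contractive weighted composition. -/
theorem weight_le_of_norm_lt_one {A : ℂ} (hA1 : ‖A‖ < 1) (B C D : ℂ) :
    ∃ M : ℝ, 0 ≤ M ∧ ∀ (f : FockSpace) (z : ℂ),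
      ‖C * Complex.exp (D * z) * f (A * z + B)‖ ^ 2 * Real.exp (-‖z‖ ^ 2) ≤
        M * (‖f (A * z + B)‖ ^ 2 * Real.exp (-‖A * z + B‖ ^ 2)) := by
  set q := 1 - ‖A‖ ^ 2 with hq
  have hqpos : 0 < q := by nlinarith [norm_nonneg A]
  set k := ‖D‖ + ‖A‖ * ‖B‖ with hk
  -- The exponent `2 Re(Dz) - ‖z‖² + ‖Az + B‖²` is at most `2k‖z‖ - q‖z‖² + ‖B‖²`, and the quadratic
  -- in `‖z‖` is at most `k² / q`.
  refine ⟨‖C‖ ^ 2 * Real.exp (k ^ 2 / q + ‖B‖ ^ 2), by positivity, fun f z => ?_⟩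
  have h1 : (D * z).re ≤ ‖D‖ * ‖z‖ := (Complex.re_le_norm _).trans (norm_mul_le _ _)
  have h2 : ‖A * z + B‖ ≤ ‖A‖ * ‖z‖ + ‖B‖ := (norm_add_le _ _).trans (by rw [norm_mul])
  have h3 : ‖A * z + B‖ ^ 2 ≤ (‖A‖ * ‖z‖ + ‖B‖) ^ 2 := by gcongr
  have h4 : 2 * k * ‖z‖ - q * ‖z‖ ^ 2 ≤ k ^ 2 / q := by
    rw [le_div_iff₀ hqpos]
    nlinarith [sq_nonneg (k - q * ‖z‖)]
  have h5 : Real.exp (D * z).re ^ 2 * Real.exp (-‖z‖ ^ 2) ≤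
      Real.exp (k ^ 2 / q + ‖B‖ ^ 2) * Real.exp (-‖A * z + B‖ ^ 2) := by
    rw [← Real.exp_nat_mul, ← Real.exp_add, ← Real.exp_add]
    apply Real.exp_le_exp.2
    push_cast
    rw [hk, hq] at h4
    rw [hk, hq]
    nlinarith
  simp only [norm_mul, Complex.norm_exp]
  calc _ = (‖C‖ ^ 2 * ‖f (A * z + B)‖ ^ 2) *
        (Real.exp (D * z).re ^ 2 * Real.exp (-‖z‖ ^ 2)) := by ring
    _ ≤ (‖C‖ ^ 2 * ‖f (A * z + B)‖ ^ 2) *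
        (Real.exp (k ^ 2 / q + ‖B‖ ^ 2) * Real.exp (-‖A * z + B‖ ^ 2)) := by gcongr
    _ = _ := by ring

theorem differentiable_affineWC (A B C D : ℂ) (f : FockSpace) :
    Differentiable ℂ fun z => C * Complex.exp (D * z) * f (A * z + B) := by
  have h2 : Differentiable ℂ fun z => f (A * z + B) := f.differentiable.comp (by fun_prop)
  exact Differentiable.mul (by fun_prop) h2

/-- A weighted composition whose composition symbol is a contraction is bounded. -/
theorem exists_affineWC {A : ℂ} (hA : A ≠ 0) (hA1 : ‖A‖ < 1) (B C D : ℂ) :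
    ∃ S : FockSpace →L[ℂ] FockSpace, ∀ f, IsAffineWC A B C D f (S f) := by
  obtain ⟨M, hM0, hM⟩ := weight_le_of_norm_lt_one hA1 B C D
  let S₀ : FockSpace →ₗ[ℂ] FockSpace :=
    { toFun := fun f => mk (fun z => C * Complex.exp (D * z) * f (A * z + B))
        (mem_of_weight_le (differentiable_affineWC A B C D f) f hA B (hM f))
      map_add' := fun f g => by ext z; simp [mul_add]
      map_smul' := fun r f => by ext z; simp [mul_left_comm] }
  refine ⟨S₀.mkContinuous (Real.sqrt (M * (‖A‖ ^ 2)⁻¹)) fun f => ?_, fun f z => rfl⟩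
  have h := norm_sq_le_of_weight_le (S₀ f) f hA B (hM f)
  rw [← Real.sqrt_sq (norm_nonneg (S₀ f)), ← Real.sqrt_sq (norm_nonneg f), ← Real.sqrt_mul (by positivity)]
  exact Real.sqrt_le_sqrt h

/-- Exponentials stay exponentials under affine substitution. Hence every maximal domain contains
all kernels, which gives density and enough test vectors. -/
theorem isAffineWC_kernel (A B C D u : ℂ) : IsAffineWC A B C D (kernel u)
    ((C * Complex.exp (conj u * B)) • kernel (conj D + u * conj A)) := fun z => by
  simp only [smul_apply, kernel_apply, map_add, map_mul, Complex.conj_conj]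
  rw [mul_assoc, mul_assoc, ← Complex.exp_add, ← Complex.exp_add]
  ring_nf

theorem IsAffineWC.unique {A B C D : ℂ} {f f₁ f₂ : FockSpace} (h₁ : IsAffineWC A B C D f f₁)
    (h₂ : IsAffineWC A B C D f f₂) : f₁ = f₂ := by
  ext z
  rw [h₁, h₂]

/-- This is the adjoint relation tested on `f = kernel u`. -/
theorem inner_kernel_image {A B C D : ℂ} {g g' : FockSpace}
    (hg : IsAffineWC (conj A) (conj D) (conj C) (conj B) g g') (u : ℂ) :
    inner ℂ ((C * Complex.exp (conj u * B)) • kernel (conj D + u * conj A)) g = g' u := by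
  rw [inner_smul_left, inner_kernel, hg]
  simp only [map_mul, ← Complex.exp_conj, Complex.conj_conj]
  ring_nf

/-- Here the operator extends to a bounded `S`, and pairing `S* g` with each kernel identifies it
pointwise with `g'`. -/
theorem inner_affineWC_of_norm_lt_one {A B C D : ℂ} (hA : A ≠ 0) (hA1 : ‖A‖ < 1)
    {f f' g g' : FockSpace} (hf : IsAffineWC A B C D f f')
    (hg : IsAffineWC (conj A) (conj D) (conj C) (conj B) g g') :
    inner ℂ f' g = inner ℂ f g' := by
  obtain ⟨S, hS⟩ := exists_affineWC hA hA1 B C D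
  rw [hf.unique (hS f), ← ContinuousLinearMap.adjoint_inner_right]
  congr 1
  ext u
  rw [← inner_kernel, ContinuousLinearMap.adjoint_inner_right,
    (hS (kernel u)).unique (isAffineWC_kernel A B C D u), inner_kernel_image hg]

/-- The dilations `f(rz)`, `r < 1`, are uniformly bounded in the graph norm of a weighted
composition. -/
theorem norm_dilation_sq_le {A B C D : ℂ} (hA : A ≠ 0) {r : ℝ} (hr : 1 / 2 ≤ r) (hr1 : r < 1)
    {f f' fr : FockSpace} (hf : IsAffineWC A B C D f f')
    (hfr : IsAffineWC (r * A) (r * B) C D f fr) :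
    ‖fr‖ ^ 2 ≤ 4 * Real.exp (‖D + conj (B / A)‖ ^ 2) * ‖f'‖ ^ 2 := by
  have hr0 : 0 < r := by linarith
  set β := B / A with hβ
  have hBA : B = A * β := by rw [hβ]; field_simp
  set δ := ‖D + conj β‖ with hδ
  have key := norm_sq_le_of_weight_le fr f' (A := r) (by exact_mod_cast hr0.ne') ((r - 1) * β)
    (M := Real.exp (δ ^ 2)) fun z => by
      rw [hfr z, hf]
      -- The point `rz + (r - 1)β` is `z` dilated by `r` about `-β`, the zero of `Az + B`. There
      -- `f'` involves the same value of `f` as `fr` does at `z`, so only exponential weights have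
      -- to be compared.
      have harg : A * (r * z + (r - 1) * β) + B = r * A * z + r * B := by rw [hBA]; ring
      rw [harg]
      simp only [norm_mul, Complex.norm_exp]
      have hexp : 2 * (D * z).re - ‖z‖ ^ 2 ≤ δ ^ 2 +
          (2 * (D * (r * z + (r - 1) * β)).re - ‖r * z + (r - 1) * β‖ ^ 2) := by
        have e1 : 2 * (D * z).re - ‖z‖ ^ 2 -
            (2 * (D * (r * z + (r - 1) * β)).re - ‖r * z + (r - 1) * β‖ ^ 2) =
            (1 - r) * (2 * ((D + conj β) * (z + β)).re - (1 + r) * ‖z + β‖ ^ 2) := by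
          simp only [← Complex.normSq_eq_norm_sq, Complex.normSq_apply]
          simp
          ring
        have e2 : ((D + conj β) * (z + β)).re ≤ δ * ‖z + β‖ :=
          (Complex.re_le_norm _).trans (norm_mul_le _ _)
        have e3 : 2 * ((D + conj β) * (z + β)).re - (1 + r) * ‖z + β‖ ^ 2 ≤ δ ^ 2 := by
          nlinarith [sq_nonneg (δ - ‖z + β‖), sq_nonneg ‖z + β‖]
        nlinarith [sq_nonneg δ]
      have h5 : Real.exp (D * z).re ^ 2 * Real.exp (-‖z‖ ^ 2) ≤ Real.exp (δ ^ 2) *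
          (Real.exp (D * (r * z + (r - 1) * β)).re ^ 2 *
            Real.exp (-‖r * z + (r - 1) * β‖ ^ 2)) := by
        simp only [← Real.exp_nat_mul, ← Real.exp_add]
        apply Real.exp_le_exp.2
        push_cast
        linarith
      calc _ = (‖C‖ * ‖f (r * A * z + r * B)‖) ^ 2 *
            (Real.exp (D * z).re ^ 2 * Real.exp (-‖z‖ ^ 2)) := by ring
        _ ≤ (‖C‖ * ‖f (r * A * z + r * B)‖) ^ 2 * (Real.exp (δ ^ 2) *
          (Real.exp (D * (r * z + (r - 1) * β)).re ^ 2 *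
            Real.exp (-‖r * z + (r - 1) * β‖ ^ 2))) := by gcongr
        _ = _ := by ring
  -- The Jacobian of the dilation; this is where `r ≥ 1/2` makes the bound uniform.
  have h4 : (‖(r : ℂ)‖ ^ 2)⁻¹ ≤ 4 := by
    rw [Complex.norm_real, Real.norm_of_nonneg hr0.le]
    rw [inv_le_comm₀ (by positivity) (by norm_num)]
    nlinarith
  calc _ ≤ _ := key
    _ ≤ Real.exp (δ ^ 2) * 4 * ‖f'‖ ^ 2 := by gcongr
    _ = _ := by ring

theorem eventually_mem_Ioo : ∀ᶠ r : ℝ in 𝓝[<] 1, 1 / 2 ≤ r ∧ r < 1 := by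
  filter_upwards [Ioo_mem_nhdsLT (show (1 / 2 : ℝ) < 1 by norm_num)] with r hr
  exact ⟨hr.1.le, hr.2⟩

/-- The dilations are bounded in norm by `norm_dilation_sq_le` and converge pointwise to `f'`, hence
weakly. -/
theorem tendsto_inner_dilation {A B C D : ℂ} (hA : A ≠ 0) {f f' : FockSpace}
    (hf : IsAffineWC A B C D f f') {u : ℝ → FockSpace}
    (hu : ∀ r : ℝ, 1 / 2 ≤ r → r < 1 → IsAffineWC (r * A) (r * B) C D f (u r)) (g : FockSpace) :
    Tendsto (fun r => inner ℂ g (u r)) (𝓝[<] 1) (𝓝 (inner ℂ g f')) := by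
  refine tendsto_inner_of_bounded
    (M := Real.sqrt (4 * Real.exp (‖D + conj (B / A)‖ ^ 2) * ‖f'‖ ^ 2)) ?_ (fun z => ?_) g
  · filter_upwards [eventually_mem_Ioo] with r hr
    exact Real.le_sqrt_of_sq_le (norm_dilation_sq_le hA hr.1 hr.2 hf (hu r hr.1 hr.2))
  · have hc : Continuous fun r : ℝ => C * Complex.exp (D * z) * f (r * A * z + r * B) := by
      have := f.continuous
      fun_prop
    have h1 : Tendsto (fun r : ℝ => C * Complex.exp (D * z) * f (r * A * z + r * B)) (𝓝[<] 1)
        (𝓝 (f' z)) := by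
      have := (hc.tendsto 1).mono_left (nhdsWithin_le_nhds (s := Set.Iio (1 : ℝ)))
      simpa [hf z] using this
    refine h1.congr' ?_
    filter_upwards [eventually_mem_Ioo] with r hr
    rw [hu r hr.1 hr.2 z]

/-- Replacing `A, B` by `rA, rB` gives a strict contraction whose formal adjoint sends `g` to
`g'(rz)`. Both sides of the identity for `r < 1` converge as `r → 1`, since `g'(rz)` is itself a
dilation of the kind treated in `tendsto_inner_dilation`. -/
theorem inner_affineWC_of_norm_le_one {A B C D : ℂ} (hA : A ≠ 0) (hA1 : ‖A‖ ≤ 1)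
    {f f' g g' : FockSpace} (hf : IsAffineWC A B C D f f')
    (hg : IsAffineWC (conj A) (conj D) (conj C) (conj B) g g') :
    inner ℂ f' g = inner ℂ f g' := by
  have hr0 : ∀ r : ℝ, 1 / 2 ≤ r → (r : ℂ) ≠ 0 := fun r hr => by
    have : r ≠ 0 := by linarith
    exact_mod_cast this
  have hrn : ∀ r : ℝ, 1 / 2 ≤ r → ‖(r : ℂ)‖ = r := fun r hr => by
    rw [Complex.norm_real, Real.norm_of_nonneg (by linarith)]
  have hex : ∀ r : ℝ, ∃ v : FockSpace, 1 / 2 ≤ r → r < 1 → IsAffineWC (r * A) (r * B) C D f v := by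
    intro r
    by_cases h : 1 / 2 ≤ r ∧ r < 1
    · have hlt : ‖(r : ℂ) * A‖ < 1 := by
        rw [norm_mul, hrn r h.1]
        nlinarith [norm_nonneg A, h.1, h.2]
      obtain ⟨S, hS⟩ := exists_affineWC (mul_ne_zero (hr0 r h.1) hA) hlt (r * B) C D
      exact ⟨S f, fun _ _ => hS f⟩
    · exact ⟨0, fun h1 h2 => absurd ⟨h1, h2⟩ h⟩
  have hex' : ∀ r : ℝ, ∃ v : FockSpace, 1 / 2 ≤ r → r < 1 →
      IsAffineWC (r * 1) (r * 0) 1 0 g' v := by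
    intro r
    by_cases h : 1 / 2 ≤ r ∧ r < 1
    · have hlt : ‖(r : ℂ) * 1‖ < 1 := by rw [mul_one, hrn r h.1]; exact h.2
      obtain ⟨S, hS⟩ := exists_affineWC (mul_ne_zero (hr0 r h.1) one_ne_zero) hlt (r * 0) 1 0
      exact ⟨S g', fun _ _ => hS g'⟩
    · exact ⟨0, fun h1 h2 => absurd ⟨h1, h2⟩ h⟩
  choose u hu using hex
  choose v hv using hex'
  have h1 := tendsto_inner_dilation hA hf hu g
  have h2 := tendsto_inner_dilation one_ne_zero
    (show IsAffineWC 1 0 1 0 g' g' from fun z => by simp) hv f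
  have h3 : Tendsto (fun r => inner ℂ (u r) g) (𝓝[<] 1) (𝓝 (inner ℂ f' g)) := by
    have := (Complex.continuous_conj.tendsto _).comp h1
    simpa only [Function.comp_def, inner_conj_symm] using this
  refine tendsto_nhds_unique h3 (h2.congr' ?_)
  filter_upwards [eventually_mem_Ioo] with r hr
  have hlt : ‖(r : ℂ) * A‖ < 1 := by
    rw [norm_mul, hrn r hr.1]
    nlinarith [norm_nonneg A, hr.1, hr.2]
  refine (inner_affineWC_of_norm_lt_one (mul_ne_zero (hr0 r hr.1) hA) hlt (hu r hr.1 hr.2)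
    fun z => ?_).symm
  rw [hv r hr.1 hr.2, hg]
  simp only [map_mul, Complex.conj_ofReal]
  ring_nf
  simp

/-- Solving `w = Az + B` for `z` gives the coefficients of the inverse. An expanding symbol becomes
contracting, which covers the case `‖A‖ > 1`. -/
theorem IsAffineWC.symm {A B C D : ℂ} (hA : A ≠ 0) (hC : C ≠ 0) {f f' : FockSpace}
    (hf : IsAffineWC A B C D f f') :
    IsAffineWC A⁻¹ (-(B * A⁻¹)) (C⁻¹ * Complex.exp (D * B * A⁻¹)) (-(D * A⁻¹)) f' f := fun z => by
  rw [hf]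
  have h1 : A * (A⁻¹ * z + -(B * A⁻¹)) + B = z := by field_simp; ring
  have h2 : Complex.exp (D * B * A⁻¹) * Complex.exp (-(D * A⁻¹) * z) *
      Complex.exp (D * (A⁻¹ * z + -(B * A⁻¹))) = 1 := by
    rw [← Complex.exp_add, ← Complex.exp_add, ← Complex.exp_zero]
    congr 1
    ring
  rw [h1]
  have h3 : C⁻¹ * C = 1 := inv_mul_cancel₀ hC
  linear_combination (-f z) * h3 - C⁻¹ * C * f z * h2

/-- Weighted compositions with affine symbols and their formal adjoints, on their maximal domains,
are adjoint to each other. -/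
theorem inner_affineWC {A B C D : ℂ} (hA : A ≠ 0) (hC : C ≠ 0)
    {f f' g g' : FockSpace} (hf : IsAffineWC A B C D f f')
    (hg : IsAffineWC (conj A) (conj D) (conj C) (conj B) g g') :
    inner ℂ f' g = inner ℂ f g' := by
  rcases le_or_gt ‖A‖ 1 with h | h
  · exact inner_affineWC_of_norm_le_one hA h hf hg
  · have hg' := hg.symm ((map_ne_zero _).2 hA) ((map_ne_zero _).2 hC)
    refine (inner_affineWC_of_norm_le_one (inv_ne_zero hA) ?_ (hf.symm hA hC) ?_).symm
    · rw [norm_inv]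
      exact inv_le_one_of_one_le₀ h.le
    · convert hg' using 1 <;> simp only [map_inv₀, map_mul, map_neg, ← Complex.exp_conj]
      ring_nf

end FockSpace

/-! ### Selfadjointness of maximal operators with respect to the conjugation. -/

namespace FockSpace

variable {a b c : ℂ}

theorem conjugation_apply (h : IsConjugationParam a b c) (f : FockSpace) (z : ℂ) :
    (conjugation a b c h).toMap f z = c * Complex.exp (b * z) * conj (f (conj (a * z + b))) := rfl

theorem IsConjugationParam.conj_mul_self (h : IsConjugationParam a b c) : conj a * a = 1 := by
  rw [Complex.conj_mul', h.norm_a]; simp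

theorem IsConjugationParam.rel' (h : IsConjugationParam a b c) : a * conj b + b = 0 := by
  have := congrArg conj h.rel
  simpa using this

theorem IsConjugationParam.c_ne_zero (h : IsConjugationParam a b c) : c ≠ 0 := by
  rintro rfl
  simpa using h.norm_c

theorem IsConjugationParam.c_mul (h : IsConjugationParam a b c) :
    c * conj c * Complex.exp (b * conj b) = 1 := by
  rw [Complex.mul_conj', Complex.mul_conj', ← Complex.ofReal_pow ‖b‖, ← Complex.ofReal_exp]
  exact_mod_cast h.norm_c

/-- The conjugation intertwines an affine weighted composition with its formal adjoint. -/
theorem IsAffineWC.conjugation (h : IsConjugationParam a b c) {A B C D : ℂ}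
    (hD : D = a * B + b * (1 - A)) {f f' : FockSpace} (hf : IsAffineWC A B C D f f') :
    IsAffineWC (conj A) (conj D) (conj C) (conj B)
      ((FockSpace.conjugation a b c h).toMap f) ((FockSpace.conjugation a b c h).toMap f') :=
    fun z => by
  have haa := h.conj_mul_self
  -- The conjugate of `hD` times `a`, using `|a| = 1` and `a * conj b = -b`. It matches both the
  -- arguments of `f` and the exponents below.
  have hDc : a * conj D = conj B - b + b * conj A := by
    rw [hD]
    simp only [map_add, map_mul, map_sub, map_one]
    linear_combination (conj B) * haa + (1 - conj A) * h.rel'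
  rw [conjugation_apply, conjugation_apply, hf]
  have harg : A * conj (a * z + b) + B = conj (a * (conj A * z + conj D) + b) := by
    apply (starRingEnd ℂ).injective
    simp only [map_add, map_mul, Complex.conj_conj]
    linear_combination -hDc
  have he : Complex.exp (b * z) * Complex.exp (conj D * (a * z + b)) =
      Complex.exp (conj B * z) * Complex.exp (b * (conj A * z + conj D)) := by
    rw [← Complex.exp_add, ← Complex.exp_add]
    congr 1
    linear_combination z * hDc
  rw [harg]
  simp only [map_mul (starRingEnd ℂ) (_ * _), map_mul (starRingEnd ℂ) C, ← Complex.exp_conj,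
    map_mul (starRingEnd ℂ) D, Complex.conj_conj]
  linear_combination c * conj C * conj (f (conj (a * (conj A * z + conj D) + b))) * he

/-- Needed to read off how `J W* J` acts. Applying the conjugation twice produces the factor `|c|²
e^{|b|²}`, which is 1. -/
theorem IsAffineWC.of_conjugation (h : IsConjugationParam a b c) {A B C D : ℂ}
    (hD : D = a * B + b * (1 - A)) {f g : FockSpace}
    (hf : IsAffineWC (conj A) (conj D) (conj C) (conj B)
      ((FockSpace.conjugation a b c h).toMap f) g) :
    IsAffineWC A B C D f ((FockSpace.conjugation a b c h).toMap g) := fun z => by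
  have haa := h.conj_mul_self
  rw [conjugation_apply, hf, conjugation_apply]
  have harg : conj (a * (conj A * conj (a * z + b) + conj D) + b) = A * z + B := by
    simp only [map_add, map_mul, Complex.conj_conj]
    rw [hD]
    linear_combination (A * z + B) * haa + h.rel
  rw [harg]
  simp only [map_mul, ← Complex.exp_conj, Complex.conj_conj, map_add]
  have he : Complex.exp (b * z) * (Complex.exp (B * (a * z + b)) *
      Complex.exp (conj b * (A * (a * z + b) + D))) =
      Complex.exp (D * z) * Complex.exp (b * conj b) := by
    simp only [← Complex.exp_add]
    congr 1
    rw [hD]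
    linear_combination (A * z + B) * h.rel'
  linear_combination c * conj c * C * f (A * z + B) * he +
    C * Complex.exp (D * z) * f (A * z + B) * h.c_mul

section Affine

variable {A B C D : ℂ} {ψ φ : ℂ → ℂ}

theorem isAffineWC_maxWCO (hψ : ∀ z, ψ z = C * Complex.exp (D * z)) (hφ : ∀ z, φ z = A * z + B)
    (f : (maxWCO ψ φ).domain) : IsAffineWC A B C D f (maxWCO ψ φ f) := fun z => by
  change ψ z * (f : FockSpace) (φ z) = _
  rw [hψ, hφ]

theorem IsAffineWC.mem_domain (hψ : ∀ z, ψ z = C * Complex.exp (D * z))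
    (hφ : ∀ z, φ z = A * z + B) {f f' : FockSpace} (hf : IsAffineWC A B C D f f') :
    f ∈ (maxWCO ψ φ).domain := by
  change (fun z => ψ z * f (φ z)) ∈ fockSubmodule
  have : (fun z => ψ z * f (φ z)) = toFun f' := by
    ext z
    rw [hf, hψ, hφ]
  rw [this]
  exact f'.2

theorem kernel_mem_domain_maxWCO (hψ : ∀ z, ψ z = C * Complex.exp (D * z))
    (hφ : ∀ z, φ z = A * z + B) (u : ℂ) : kernel u ∈ (maxWCO ψ φ).domain :=
  (isAffineWC_kernel A B C D u).mem_domain hψ hφ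

theorem dense_domain_maxWCO (hψ : ∀ z, ψ z = C * Complex.exp (D * z)) (hφ : ∀ z, φ z = A * z + B) :
    Dense ((maxWCO ψ φ).domain : Set FockSpace) :=
  dense_of_kernel_mem _ fun u => kernel_mem_domain_maxWCO hψ hφ u

/-- By `inner_affineWC`, pairing with `J f` is adjoint to the weighted composition for every `f` in
the maximal domain. Allowing any densely defined restriction `W` serves both the selfadjointness of
the maximal operator and the maximality of selfadjoint restrictions. -/
theorem maxWCO_le_conjugate_adjoint (h : IsConjugationParam a b c) (hA : A ≠ 0) (hC : C ≠ 0)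
    (hD : D = a * B + b * (1 - A)) (hψ : ∀ z, ψ z = C * Complex.exp (D * z))
    (hφ : ∀ z, φ z = A * z + B) {W : FockSpace →ₗ.[ℂ] FockSpace} (hW : W ≤ maxWCO ψ φ)
    (hd : Dense (W.domain : Set FockSpace)) :
    maxWCO ψ φ ≤ (conjugation a b c h).conjugate W.adjoint := by
  have key : ∀ (f : (maxWCO ψ φ).domain) (g : W.domain),
      inner ℂ ((conjugation a b c h).toMap (maxWCO ψ φ f)) (g : FockSpace) =
        inner ℂ ((conjugation a b c h).toMap f) (W g) := fun f g => by
    have h1 := (isAffineWC_maxWCO hψ hφ f).conjugation h hD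
    have h2 := isAffineWC_maxWCO hψ hφ ⟨g, hW.1 g.2⟩
    rw [← hW.2 (x := g) (y := ⟨g, hW.1 g.2⟩) rfl] at h2
    rw [← inner_conj_symm, ← inner_affineWC hA hC h2 h1, inner_conj_symm]
  have hmem : ∀ f : (maxWCO ψ φ).domain,
      (conjugation a b c h).toMap f ∈ W.adjoint.domain := fun f =>
    LinearPMap.mem_adjoint_domain_of_exists _ ⟨_, key f⟩
  refine ⟨fun f hf => hmem ⟨f, hf⟩, fun f g hfg => ?_⟩
  obtain ⟨g, hg⟩ := g
  obtain rfl : (f : FockSpace) = g := hfg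
  change _ = (conjugation a b c h).toMap (W.adjoint ⟨_, hg⟩)
  rw [LinearPMap.adjoint_apply_eq hd ⟨_, hg⟩ (key f), (conjugation a b c h).involutive]

/-- The kernels lie in the maximal domain, so pairing with them evaluates the adjoint pointwise: it
can only act as the formal adjoint. -/
theorem conjugate_adjoint_maxWCO_le (h : IsConjugationParam a b c)
    (hD : D = a * B + b * (1 - A)) (hψ : ∀ z, ψ z = C * Complex.exp (D * z))
    (hφ : ∀ z, φ z = A * z + B) :
    (conjugation a b c h).conjugate (maxWCO ψ φ).adjoint ≤ maxWCO ψ φ := by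
  have hd := dense_domain_maxWCO hψ hφ
  have key : ∀ f : ((conjugation a b c h).conjugate (maxWCO ψ φ).adjoint).domain,
      IsAffineWC A B C D f ((conjugation a b c h).conjugate (maxWCO ψ φ).adjoint f) := fun f => by
    refine IsAffineWC.of_conjugation h hD fun u => ?_
    have hk := isAffineWC_kernel A B C D u
    have h1 := (LinearPMap.adjoint_isFormalAdjoint hd).symm
      ⟨kernel u, kernel_mem_domain_maxWCO hψ hφ u⟩ ⟨_, f.2⟩
    rw [(isAffineWC_maxWCO hψ hφ _).unique hk, inner_kernel, inner_smul_left, inner_kernel] at h1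
    rw [← h1]
    simp only [map_mul, ← Complex.exp_conj, Complex.conj_conj]
    ring_nf
  refine ⟨fun f hf => (key ⟨f, hf⟩).mem_domain hψ hφ, fun f g hfg => ?_⟩
  have h2 := isAffineWC_maxWCO hψ hφ g
  rw [← hfg] at h2
  exact (key f).unique h2

/-- Maximal weighted composition operators with matching affine symbols are `C`-selfadjoint. -/
theorem isCSelfadjoint_maxWCO (h : IsConjugationParam a b c) (hA : A ≠ 0) (hC : C ≠ 0)
    (hD : D = a * B + b * (1 - A)) (hψ : ∀ z, ψ z = C * Complex.exp (D * z))
    (hφ : ∀ z, φ z = A * z + B) : IsCSelfadjoint (conjugation a b c h) (maxWCO ψ φ) :=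
  have hd := dense_domain_maxWCO hψ hφ
  ⟨hd, le_antisymm (maxWCO_le_conjugate_adjoint h hA hC hD hψ hφ le_rfl hd)
    (conjugate_adjoint_maxWCO_le h hD hψ hφ)⟩

/-- The chain `W ≤ max ≤ J W* J = W` closes up. -/
theorem eq_maxWCO_of_isCSelfadjoint (h : IsConjugationParam a b c) (hA : A ≠ 0) (hC : C ≠ 0)
    (hD : D = a * B + b * (1 - A)) (hψ : ∀ z, ψ z = C * Complex.exp (D * z))
    (hφ : ∀ z, φ z = A * z + B) {W : FockSpace →ₗ.[ℂ] FockSpace} (hW : W ≤ maxWCO ψ φ)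
    (hs : IsCSelfadjoint (conjugation a b c h) W) : W = maxWCO ψ φ := by
  refine le_antisymm hW ?_
  have h1 := maxWCO_le_conjugate_adjoint h hA hC hD hψ hφ hW hs.1
  rwa [← hs.2] at h1

end Affine

/-! ### The functional equation for the symbols. -/

/-- The symbols of a `C`-selfadjoint weighted composition operator satisfy a symmetric functional
equation. -/
theorem symbol_equation (h : IsConjugationParam a b c) {ψ φ : ℂ → ℂ}
    {W : FockSpace →ₗ.[ℂ] FockSpace} (hW : W ≤ maxWCO ψ φ)
    (hs : IsCSelfadjoint (conjugation a b c h) W) (z w : ℂ) :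
    ψ z * Complex.exp (b * w + (b + a * w) * φ z) =
      ψ w * Complex.exp (b * φ w + (b + a * φ w) * z) := by
  set J := conjugation a b c h with hJ
  have hval : ∀ (f : W.domain) (z : ℂ), W f z = ψ z * (f : FockSpace) (φ z) := fun f z => by
    rw [hW.2 (x := f) (y := ⟨f, hW.1 f.2⟩) rfl]
    rfl
  -- The functional `g ↦ (W g)(w) = ψ(w) g(φ(w))` is represented by a multiple of a kernel, which
  -- puts `kernel w` in the domain of the adjoint.
  have hadj : ∀ g : W.domain, inner ℂ (conj (ψ w) • kernel (φ w)) (g : FockSpace) =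
      inner ℂ (kernel w) (W g) := fun g => by
    rw [inner_smul_left, inner_kernel, inner_kernel, hval, Complex.conj_conj]
  have hk : kernel w ∈ W.adjoint.domain := LinearPMap.mem_adjoint_domain_of_exists _ ⟨_, hadj⟩
  have hJk : J.toMap (kernel w) ∈ (J.conjugate W.adjoint).domain := by
    change J.toMap (J.toMap (kernel w)) ∈ W.adjoint.domain
    rwa [J.involutive]
  have hJW : J.toMap (kernel w) ∈ W.domain := by
    rw [hs.2]
    exact hJk
  have e1 : W ⟨J.toMap (kernel w), hJW⟩ = J.toMap (conj (ψ w) • kernel (φ w)) := by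
    have e2 : W ⟨J.toMap (kernel w), hJW⟩ =
        J.conjugate W.adjoint ⟨J.toMap (kernel w), hJk⟩ :=
      (le_of_eq hs.2).2 (x := ⟨J.toMap (kernel w), hJW⟩) (y := ⟨J.toMap (kernel w), hJk⟩) rfl
    rw [e2]
    change J.toMap (W.adjoint ⟨J.toMap (J.toMap (kernel w)), _⟩) = _
    rw [← LinearPMap.adjoint_apply_eq hs.1 ⟨kernel w, hk⟩ hadj]
    congr 3
    exact J.involutive _
  have hc := h.c_ne_zero
  have e3 := hval ⟨J.toMap (kernel w), hJW⟩ z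
  have hJker : ∀ w z, J.toMap (kernel w) z = c * Complex.exp (b * w + (b + a * w) * z) :=
      fun w z => by
    rw [hJ, conjugation_apply, kernel_apply, ← Complex.exp_conj, mul_assoc, ← Complex.exp_add]
    simp only [map_mul, Complex.conj_conj]
    ring_nf
  rw [e1, J.toMap.map_smulₛₗ, smul_apply, Complex.conj_conj, hJker] at e3
  simp only [hJker] at e3
  apply mul_left_cancel₀ hc
  linear_combination -e3

/-- Solutions of the symmetric functional equation are affine and exponential. -/
theorem affine_of_symbol_equation {ψ φ : ℂ → ℂ} (ha : a ≠ 0) (hφ : Continuous φ)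
    (hψ : ∃ z, ψ z ≠ 0)
    (h : ∀ z w, ψ z * Complex.exp (b * w + (b + a * w) * φ z) =
      ψ w * Complex.exp (b * φ w + (b + a * φ w) * z)) :
    (∀ z, φ z = (φ 1 - φ 0) * z + φ 0) ∧ ψ 0 ≠ 0 ∧
      ∀ z, ψ z = ψ 0 * Complex.exp ((a * φ 0 + b * (1 - (φ 1 - φ 0))) * z) := by
  have h0 : ∀ z, ψ z * Complex.exp (b * φ z) =
      ψ 0 * Complex.exp (b * φ 0 + (b + a * φ 0) * z) := fun z => by simpa using h z 0
  have hψ0 : ψ 0 ≠ 0 := by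
    obtain ⟨z, hz⟩ := hψ
    intro h1
    have := h0 z
    rw [h1, zero_mul] at this
    exact (mul_ne_zero hz (Complex.exp_ne_zero _)) this
  -- Substituting `h0` for both `z` and `w` cancels `ψ` and leaves a condition on `φ` alone.
  have hexp : ∀ z w, Complex.exp (a * (w * (φ z - φ 0) - z * (φ w - φ 0))) = 1 := fun z w => by
    have e1 := h z w
    have e2 := h0 z
    have e3 := h0 w
    have e4 : ψ 0 * Complex.exp (b * φ 0 + (b + a * φ 0) * z) * Complex.exp (b * w + a * w * φ z) =
        ψ 0 * Complex.exp (b * φ 0 + (b + a * φ 0) * w) *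
          Complex.exp (b * z + a * φ w * z) := by
      rw [← e2, ← e3, mul_assoc (ψ z), mul_assoc (ψ w), ← Complex.exp_add, ← Complex.exp_add]
      convert e1 using 3 <;> ring
    rw [mul_assoc (ψ 0), mul_assoc (ψ 0)] at e4
    have e5 := mul_left_cancel₀ hψ0 e4
    rw [← Complex.exp_add, ← Complex.exp_add] at e5
    have e6 : Complex.exp (a * (w * (φ z - φ 0) - z * (φ w - φ 0))) =
        Complex.exp (b * φ 0 + (b + a * φ 0) * z + (b * w + a * w * φ z)) /
          Complex.exp (b * φ 0 + (b + a * φ 0) * w + (b * z + a * φ w * z)) := by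
      rw [← Complex.exp_sub]
      ring_nf
    rw [e6, e5, div_self (Complex.exp_ne_zero _)]
  have hlin : ∀ z w, w * (φ z - φ 0) - z * (φ w - φ 0) = 0 := fun z w => by
    -- Along the line through 0 and `z` the exponent is continuous, takes values in `2πiℤ` and
    -- vanishes at `t = 0`, so it is identically zero.
    set F : ℝ → ℂ := fun t => a * (w * (φ (t * z) - φ 0) - (t * z) * (φ w - φ 0)) with hF
    have hFc : Continuous F := by fun_prop
    have hF0 : F 0 = 0 := by simp [hF]
    have hint : ∀ t, ∃ n : ℤ, F t = n * (2 * Real.pi * Complex.I) := fun t =>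
      Complex.exp_eq_one_iff.1 (hexp (t * z) w)
    choose n hn using hint
    have h2pi : (2 * Real.pi * Complex.I : ℂ) ≠ 0 := Complex.two_pi_I_ne_zero
    have hnc : Continuous n := by
      have h1 : Continuous fun t => ((n t : ℤ) : ℂ) := by
        have : (fun t => ((n t : ℤ) : ℂ)) = fun t => F t / (2 * Real.pi * Complex.I) := by
          ext t
          rw [hn t, mul_div_cancel_right₀ _ h2pi]
        rw [this]
        exact hFc.div_const _
      have h2 : IsClosedEmbedding (fun n : ℤ => (n : ℂ)) := Complex.isClosedEmbedding_intCast
      exact h2.isEmbedding.continuous_iff.2 h1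
    have hconst := PreconnectedSpace.constant (inferInstance : PreconnectedSpace ℝ) hnc (x := 1) (y := 0)
    have h1 : F 1 = 0 := by rw [hn 1, hconst, ← hn 0, hF0]
    have h2 : a * (w * (φ z - φ 0) - z * (φ w - φ 0)) = 0 := by simpa [hF] using h1
    exact (mul_eq_zero.1 h2).resolve_left ha
  have hφa : ∀ z, φ z = (φ 1 - φ 0) * z + φ 0 := fun z => by
    linear_combination hlin z 1
  refine ⟨hφa, hψ0, fun z => ?_⟩
  apply mul_right_cancel₀ (Complex.exp_ne_zero (b * φ z))
  rw [h0, mul_assoc, ← Complex.exp_add]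
  congr 2
  linear_combination -b * hφa z

end FockSpace

/-! ### Functional equations in time. -/

/-- A continuous nonzero multiplicative function on `[0, ∞)` is an exponential. -/
theorem eq_exp_of_continuousOn_of_mul {f : ℝ → ℂ} (hc : ContinuousOn f (Set.Ici 0)) (h0 : f 0 = 1)
    (hm : ∀ t s : ℝ, 0 ≤ t → 0 ≤ s → f (t + s) = f t * f s) :
    ∃ k : ℂ, ∀ t : ℝ, 0 ≤ t → f t = Complex.exp (k * t) := by
  -- The even extension is used only for its continuity on the whole line, which makes the primitive
  -- `F` differentiable everywhere.
  set g : ℝ → ℂ := fun t => f |t| with hg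
  have hgc : Continuous g := hc.comp_continuous continuous_abs fun t => abs_nonneg t
  have hgf : ∀ t, 0 ≤ t → g t = f t := fun t ht => by simp only [hg, abs_of_nonneg ht]
  set F : ℝ → ℂ := fun x => ∫ s in (0 : ℝ)..x, g s with hF
  have hFd : ∀ x, HasDerivAt F (g x) x := fun x => hgc.integral_hasStrictDerivAt 0 x |>.hasDerivAt
  -- Otherwise the right derivative of `F` at 0 would vanish, whereas it equals `f 0 = 1`.
  obtain ⟨δ, hδ, hFδ⟩ : ∃ δ : ℝ, 0 < δ ∧ F δ ≠ 0 := by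
    by_contra! hcon
    have h1 : HasDerivWithinAt F 0 (Set.Ici 0) 0 :=
      (hasDerivWithinAt_const (0 : ℝ) (Set.Ici 0) (0 : ℂ)).congr (fun x hx => by
        rcases (show (0 : ℝ) ≤ x from hx).eq_or_lt with h | h
        · simp [hF, ← h]
        · exact hcon x h) (by simp [hF])
    have h2 := (uniqueDiffOn_Ici (0 : ℝ) 0 Set.self_mem_Ici).eq_deriv _ h1 (hFd 0).hasDerivWithinAt
    rw [hgf 0 le_rfl, h0] at h2
    exact zero_ne_one h2
  -- Integrating `f(t + s) = f(t) f(s)` over `s ∈ [0, δ]` expresses `f` through its primitive, so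
  -- continuity upgrades to right differentiability with `f' = k f`.
  have hrep : ∀ t, 0 ≤ t → f t * F δ = F (t + δ) - F t := fun t ht => by
    have h1 : F (t + δ) - F t = ∫ s in t..t + δ, g s :=
      intervalIntegral.integral_interval_sub_left (hgc.intervalIntegrable _ _)
        (hgc.intervalIntegrable _ _)
    have h2 : ∫ s in t..t + δ, g s = ∫ s in (0 : ℝ)..δ, g (t + s) := by
      rw [intervalIntegral.integral_comp_add_left]
      simp
    rw [h1, h2, hF, ← intervalIntegral.integral_const_mul]
    refine intervalIntegral.integral_congr fun s hs => ?_
    rw [Set.uIcc_of_le hδ.le] at hs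
    rw [hgf s hs.1, hgf (t + s) (add_nonneg ht hs.1), hm t s ht hs.1]
  set k := (f δ - 1) / F δ with hk
  have hd : ∀ t, 0 ≤ t → HasDerivWithinAt f (k * f t) (Set.Ici t) t := fun t ht => by
    have h1 : HasDerivAt (fun t => (F (t + δ) - F t) / F δ) ((g (t + δ) - g t) / F δ) t :=
      (((hFd (t + δ)).comp_add_const t δ).sub (hFd t)).div_const _
    have e : (g (t + δ) - g t) / F δ = k * f t := by
      rw [hgf _ (add_nonneg ht hδ.le), hgf t ht, hm t δ ht hδ.le, hk]
      ring
    rw [e] at h1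
    have h2 : ∀ x, 0 ≤ x → f x = (F (x + δ) - F x) / F δ := fun x hx => by
      rw [← hrep x hx, mul_div_cancel_right₀ _ hFδ]
    exact h1.hasDerivWithinAt.congr (fun x hx => h2 x (ht.trans hx)) (h2 t ht)
  refine ⟨k, fun t ht => ?_⟩
  have hE : ∀ x : ℝ, HasDerivAt (fun x : ℝ => Complex.exp (-k * x))
      (Complex.exp (-k * x) * (-k)) x := fun x => by
    have := ((Complex.ofRealCLM.hasDerivAt (x := x)).const_mul (-k)).cexp
    simpa using this
  have hconst := constant_of_has_deriv_right_zero (f := fun x : ℝ => f x * Complex.exp (-k * x))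
    (a := 0) (b := t) ?_ ?_ t ⟨ht, le_rfl⟩
  · simp only [h0, Complex.ofReal_zero, mul_zero, Complex.exp_zero, mul_one] at hconst
    rw [neg_mul, Complex.exp_neg] at hconst
    exact (mul_inv_eq_one₀ (Complex.exp_ne_zero _)).1 hconst
  · exact (hc.mono Set.Icc_subset_Ici_self).mul (by fun_prop)
  · intro x hx
    refine ((hd x hx.1).mul (hE x).hasDerivWithinAt).congr_deriv ?_
    ring

/-- A continuous additive function on `[0, ∞)` is linear. -/
theorem eq_mul_of_continuousOn_of_add {f : ℝ → ℂ} (hc : ContinuousOn f (Set.Ici 0))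
    (hm : ∀ t s : ℝ, 0 ≤ t → 0 ≤ s → f (t + s) = f t + f s) :
    ∃ k : ℂ, ∀ t : ℝ, 0 ≤ t → f t = k * t := by
  have h0 : f 0 = 0 := by simpa using hm 0 0 le_rfl le_rfl
  -- The odd extension of `f`, an additive map on all of `ℝ`; a continuous additive map is real
  -- linear.
  let φ : ℝ →+ ℂ := AddMonoidHom.mk' (fun t => f (max t 0) - f (max (-t) 0)) fun t s => by
    have key : ∀ t s : ℝ, f (max (t + s) 0) + f (max (-t) 0) + f (max (-s) 0) =
        f (max (-(t + s)) 0) + f (max t 0) + f (max s 0) := fun t s => by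
      have p : ∀ x : ℝ, 0 ≤ max x 0 := fun x => le_max_right _ _
      rw [← hm _ _ (p _) (p _), ← hm _ _ (p _) (p _),
        ← hm _ _ (add_nonneg (p _) (p _)) (p _), ← hm _ _ (add_nonneg (p _) (p _)) (p _)]
      congr 1
      have q : ∀ x : ℝ, max x 0 = max (-x) 0 + x := fun x => by
        rcases le_total x 0 with h | h
        · rw [max_eq_right h, max_eq_left (by linarith)]; ring
        · rw [max_eq_left h, max_eq_right (by linarith)]; ring
      linarith [q (t + s), q t, q s]
    linear_combination key t s
  have hφc : Continuous φ := by
    have h1 : Continuous fun t : ℝ => f (max t 0) :=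
      hc.comp_continuous (by fun_prop) fun t => Set.mem_Ici.2 (le_max_right _ _)
    exact h1.sub (h1.comp continuous_neg)
  have hφ : ∀ t, 0 ≤ t → φ t = f t := fun t ht => by
    change f (max t 0) - f (max (-t) 0) = f t
    rw [max_eq_left ht, max_eq_right (by linarith), h0, sub_zero]
  refine ⟨f 1, fun t ht => ?_⟩
  have h1 := map_real_smul φ hφc t 1
  rw [smul_eq_mul, mul_one, hφ t ht, hφ 1 zero_le_one, Complex.real_smul] at h1
  rw [h1, mul_comm]

/-- The symbols of a semicocycle do not vanish identically. -/
theorem IsSemicocycle.exists_ne_zero {ζ ξ : ℝ → ℂ → ℂ} (hζ : IsSemiflow ζ)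
    (hξ : IsSemicocycle ζ ξ) {t : ℝ} (ht : 0 ≤ t) : ∃ z, ξ t z ≠ 0 := by
  by_contra! hcon
  -- If `ξ_s` vanishes identically, so does the product of `ξ_{s/2}` and `ξ_{s/2} ∘ ζ_{s/2}`. By the
  -- identity theorem one factor is zero, and since the nonconstant `ζ_{s/2}` is open, either case
  -- gives `ξ_{s/2} = 0`.
  have hstep : ∀ s : ℝ, 0 ≤ s → (∀ z, ξ s z = 0) → ∀ z, ξ (s / 2) z = 0 := by
    intro s hs h
    have hs2 : 0 ≤ s / 2 := by linarith
    have hprod : ∀ z, ξ (s / 2) z * ξ (s / 2) (ζ (s / 2) z) = 0 := fun z => by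
      rw [← hξ.add _ _ hs2 hs2, add_halves, h]
    have hd := hξ.entire _ hs2
    have han : AnalyticOnNhd ℂ (ξ (s / 2)) Set.univ := fun z _ => hd.analyticAt z
    have hanζ : AnalyticOnNhd ℂ (ζ (s / 2)) Set.univ := fun z _ =>
      (hζ.entire _ hs2).analyticAt z
    by_contra! hne
    obtain ⟨z₀, hz₀⟩ := hne
    have hev : ∀ᶠ z in 𝓝 z₀, ξ (s / 2) z ≠ 0 := hd.continuous.continuousAt.eventually_ne hz₀
    have hcomp : ∀ z, ξ (s / 2) (ζ (s / 2) z) = 0 := by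
      have hanc : AnalyticOnNhd ℂ (fun z => ξ (s / 2) (ζ (s / 2) z)) Set.univ := fun z _ =>
        (hd.comp (hζ.entire _ hs2)).analyticAt z
      have := hanc.eq_of_eventuallyEq (g := fun _ => 0) (z₀ := z₀) (fun z _ => analyticAt_const)
        (by filter_upwards [hev] with z hz using (mul_eq_zero.1 (hprod z)).resolve_left hz)
      exact congrFun this
    rcases hanζ.is_constant_or_isOpen isPreconnected_univ with ⟨w, hw⟩ | hopen
    · exact hζ.nonconstant _ hs2 ⟨w, fun z => hw z (Set.mem_univ z)⟩
    · have ho := hopen Set.univ le_rfl isOpen_univ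
      have hz : ξ (s / 2) =ᶠ[𝓝 (ζ (s / 2) 0)] fun _ => 0 := by
        filter_upwards [ho.mem_nhds ⟨0, Set.mem_univ _, rfl⟩]
        rintro _ ⟨z, -, rfl⟩
        exact hcomp z
      exact hz₀ (congrFun (han.eq_of_eventuallyEq (fun z _ => analyticAt_const) hz) z₀)
  have hall : ∀ n : ℕ, ∀ z, ξ (t / 2 ^ n) z = 0 := by
    intro n
    induction n with
    | zero => simpa using hcon
    | succ n ih =>
      rw [pow_succ, ← div_div]
      exact hstep _ (by positivity) ih
  -- Halving repeatedly contradicts continuity in time at 0, where `ξ_0 = 1`.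
  have hlim : Tendsto (fun n : ℕ => t / 2 ^ n) atTop (𝓝[Set.Ici 0] 0) := by
    refine tendsto_nhdsWithin_iff.2 ⟨?_, Eventually.of_forall fun n => by
      change 0 ≤ t / 2 ^ n; positivity⟩
    have := (tendsto_pow_atTop_nhds_zero_of_lt_one (r := (1 / 2 : ℝ)) (by norm_num)
      (by norm_num)).const_mul t
    simpa [div_eq_mul_inv] using this
  have h1 := ((hξ.differentiable 0).continuousOn 0 Set.self_mem_Ici).tendsto.comp hlim
  simp only [Function.comp_def, hall, hξ.zero] at h1
  exact zero_ne_one (tendsto_nhds_unique tendsto_const_nhds h1)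

/-- Solution of the functional equations for the coefficients of an affine semiflow and an
exponential semicocycle. -/
theorem coefficient_types {a b : ℂ} {A B C D : ℝ → ℂ} (hA : ContinuousOn A (Set.Ici 0))
    (hB : ContinuousOn B (Set.Ici 0)) (hC : ContinuousOn C (Set.Ici 0)) (hA0 : A 0 = 1)
    (hC0 : C 0 = 1) (hAm : ∀ t s : ℝ, 0 ≤ t → 0 ≤ s → A (t + s) = A t * A s)
    (hBm : ∀ t s : ℝ, 0 ≤ t → 0 ≤ s → B (t + s) = A t * B s + B t)
    (hCm : ∀ t s : ℝ, 0 ≤ t → 0 ≤ s → C (t + s) = C t * C s * Complex.exp (D s * B t))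
    (hD : ∀ t, 0 ≤ t → D t = a * B t + b * (1 - A t)) :
    IsTranslationType a A B C D ∨ IsAffineExponentialType a b A B C D := by
  obtain ⟨l, hl⟩ := eq_exp_of_continuousOn_of_mul hA hA0 hAm
  rcases eq_or_ne l 0 with rfl | hl0
  · left
    have hA1 : ∀ t : ℝ, 0 ≤ t → A t = 1 := fun t ht => by simpa using hl t ht
    obtain ⟨E, hE⟩ := eq_mul_of_continuousOn_of_add hB fun t s ht hs => by
      rw [hBm t s ht hs, hA1 t ht]; ring
    have hDt : ∀ t : ℝ, 0 ≤ t → D t = a * E * t := fun t ht => by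
      rw [hD t ht, hA1 t ht, hE t ht]; ring
    -- The twist `D s * B t = a E² s t` is the polarization of `a E² t² / 2`; dividing out that
    -- exponential leaves a multiplicative function.
    obtain ⟨F, hF⟩ := eq_exp_of_continuousOn_of_mul
      (f := fun t : ℝ => C t * Complex.exp (-(a * E ^ 2 * t ^ 2 / 2))) (hC.mul (by fun_prop))
      (by simp [hC0]) fun t s ht hs => by
        rw [hCm t s ht hs, hDt s hs, hE t ht]
        have : Complex.exp (a * E * s * (E * t)) *
            Complex.exp (-(a * E ^ 2 * ((t + s : ℝ) : ℂ) ^ 2 / 2)) =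
            Complex.exp (-(a * E ^ 2 * t ^ 2 / 2)) * Complex.exp (-(a * E ^ 2 * s ^ 2 / 2)) := by
          rw [← Complex.exp_add, ← Complex.exp_add]
          congr 1
          push_cast
          ring
        linear_combination C t * C s * this
    refine ⟨E, F, fun t ht => ⟨hA1 t ht, hE t ht, hDt t ht, ?_⟩⟩
    have h1 := hF t ht
    simp only [Complex.exp_neg] at h1
    rw [Complex.exp_add, ← h1, inv_mul_cancel_right₀ (Complex.exp_ne_zero _)]
  · right
    obtain ⟨t₀, ht₀, hne⟩ : ∃ t₀ : ℝ, 0 ≤ t₀ ∧ A t₀ ≠ 1 := by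
      by_contra! hcon
      have hd1 : HasDerivWithinAt (fun t : ℝ => Complex.exp (l * t)) 0 (Set.Ici 0) 0 :=
        (hasDerivWithinAt_const (0 : ℝ) (Set.Ici 0) (1 : ℂ)).congr
          (fun x hx => by rw [← hl x hx, hcon x hx]) (by simp)
      have hd2 : HasDerivAt (fun t : ℝ => Complex.exp (l * t)) l 0 := by
        have := ((Complex.ofRealCLM.hasDerivAt (x := 0)).const_mul l).cexp
        simpa using this
      exact hl0 ((uniqueDiffOn_Ici (0 : ℝ) 0 Set.self_mem_Ici).eq_deriv _
        hd2.hasDerivWithinAt hd1)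
    have hne' : 1 - A t₀ ≠ 0 := sub_ne_zero.2 hne.symm
    -- `G` is the common fixed point of the flow: computing `B (t + t₀)` in both orders shows that
    -- `B t` is the same multiple of `1 - A t` for every `t`.
    set G := B t₀ / (1 - A t₀) with hG
    have hBt : ∀ t : ℝ, 0 ≤ t → B t = G * (1 - A t) := fun t ht => by
      have h1 := hBm t t₀ ht ht₀
      rw [add_comm, hBm t₀ t ht₀ ht] at h1
      rw [hG]
      field_simp
      linear_combination -h1
    have hDt : ∀ t : ℝ, 0 ≤ t → D t = (a * G + b) * (1 - A t) := fun t ht => by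
      rw [hD t ht, hBt t ht]; ring
    -- With `p = G(aG + b)`, the twist `p(1 - A s)(1 - A t)` is `p(A - 1)` at `t + s` minus its
    -- values at `t` and at `s`, so it can again be divided out.
    obtain ⟨k, hk⟩ := eq_exp_of_continuousOn_of_mul
      (f := fun t : ℝ => C t * Complex.exp (-(G * (a * G + b) * (A t - 1))))
      (hC.mul (by fun_prop)) (by simp [hC0, hA0]) fun t s ht hs => by
        rw [hCm t s ht hs, hDt s hs, hBt t ht, hAm t s ht hs]
        have : Complex.exp ((a * G + b) * (1 - A s) * (G * (1 - A t))) *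
            Complex.exp (-(G * (a * G + b) * (A t * A s - 1))) =
            Complex.exp (-(G * (a * G + b) * (A t - 1))) *
              Complex.exp (-(G * (a * G + b) * (A s - 1))) := by
          rw [← Complex.exp_add, ← Complex.exp_add]
          congr 1
          ring
        linear_combination C t * C s * this
    -- The shift of `k` compensates the term `-l * t` in the normal form of `C`.
    refine ⟨l, G, k + G * (a * G + b) * l, hl0, fun t ht => ⟨hl t ht, ?_, ?_, ?_⟩⟩
    · rw [hBt t ht, hl t ht]
    · rw [hDt t ht, hl t ht]
    · have h1 := hk t ht
      simp only [Complex.exp_neg] at h1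
      have e : (k + G * (a * G + b) * l) * t + G * (a * G + b) * (Complex.exp (l * t) - l * t - 1) =
          k * t + G * (a * G + b) * (A t - 1) := by rw [hl t ht]; ring
      rw [e, Complex.exp_add, ← h1, inv_mul_cancel_right₀ (Complex.exp_ne_zero _)]

/-! ### The semigroup vector and the characterization. -/

namespace FockSpace

theorem IsWCO.apply {W : FockSpace →ₗ.[ℂ] FockSpace} {ψ φ : ℂ → ℂ} (hW : IsWCO W ψ φ)
    (f : W.domain) (z : ℂ) : W f z = ψ z * (f : FockSpace) (φ z) := by
  rw [hW.2 (x := f) (y := ⟨f, hW.1 f.2⟩) rfl]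
  rfl

/-- The constant function is a semigroup vector of a maximal weighted composition semigroup with
affine and exponential symbols. -/
theorem isSemigroupVector_kernel_zero {ζ ξ : ℝ → ℂ → ℂ} (hζ : IsSemiflow ζ)
    (hξ : IsSemicocycle ζ ξ) {W : ℝ → FockSpace →ₗ.[ℂ] FockSpace}
    (hmax : ∀ t : ℝ, 0 ≤ t → W t = maxWCO (ξ t) (ζ t)) {A B C D : ℝ → ℂ}
    (hφ : ∀ t : ℝ, 0 ≤ t → ∀ z, ζ t z = A t * z + B t)
    (hψ : ∀ t : ℝ, 0 ≤ t → ∀ z, ξ t z = C t * Complex.exp (D t * z))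
    {C' D' : ℝ → ℂ} (hC : Continuous C') (hD : Continuous D')
    (hC' : ∀ t, 0 ≤ t → C t = C' t) (hD' : ∀ t, 0 ≤ t → D t = D' t) (hC0 : C' 0 = 1)
    (hD0 : D' 0 = 0) : IsSemigroupVector W (kernel 0) := by
  have hW : ∀ t, 0 ≤ t → IsWCO (W t) (ξ t) (ζ t) := fun t ht => (hmax t ht).le
  have hdom : ∀ t, 0 ≤ t → ∀ u, kernel u ∈ (W t).domain := fun t ht u => by
    rw [hmax t ht]
    exact kernel_mem_domain_maxWCO (hψ t ht) (hφ t ht) u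
  -- Since `kernel 0` is the constant 1, its orbit is `ξ_t` itself. The functions `C'` and `D'`
  -- agree with `C` and `D` for `t ≥ 0` and are continuous on the whole line.
  have hval : ∀ t, 0 ≤ t → ∀ h : kernel 0 ∈ (W t).domain,
      W t ⟨kernel 0, h⟩ = C' t • kernel (conj (D' t)) := fun t ht h => by
    ext z
    rw [(hW t ht).apply, hψ t ht, hC' t ht, hD' t ht]
    simp [kernel_apply]
  have hcont : Continuous fun t => C' t • kernel (conj (D' t)) :=
    hC.smul (continuous_kernel.comp (Complex.continuous_conj.comp hD))
  refine ⟨fun h => ?_, fun t s ht hs => ⟨hdom s hs 0, ?_⟩, fun t s ht hs h₁ h₂ h₃ => ?_,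
    fun t => C' t • kernel (conj (D' t)), fun t ht => ⟨hdom t ht 0, hval t ht _⟩,
    hcont.continuousOn, ?_⟩
  · have := congrArg (fun f : FockSpace => f 0) h
    simp [kernel_apply] at this
  · rw [hval s hs]
    exact (W t).domain.smul_mem _ (hdom t ht _)
  · ext z
    rw [(hW t ht).apply, (hW _ (add_nonneg ht hs)).apply]
    simp only
    -- The product `T(t) T(s)` composes with `ζ_s ∘ ζ_t`, so the flow law is applied with the times
    -- in the opposite order to the cocycle law.
    rw [(hW s hs).apply, hξ.add t s ht hs, add_comm t s, hζ.add s t hs ht, mul_assoc]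
  · have h1 := ((hcont.sub (continuous_const (y := FockSpace.kernel 0))).norm.tendsto 0).mono_left
      (nhdsWithin_le_nhds (s := Set.Ioi (0 : ℝ)))
    simpa [hC0, hD0] using h1

end FockSpace

theorem theorem6 (a b c : ℂ) (habc : FockSpace.IsConjugationParam a b c)
    (ζ ξ : ℝ → ℂ → ℂ) (hζ : IsSemiflow ζ) (hξ : IsSemicocycle ζ ξ)
    (W : ℝ → FockSpace →ₗ.[ℂ] FockSpace) (hW : IsWCSemigroup W ξ ζ) :
    IsCSelfadjointUnboundedC0Semigroup (FockSpace.conjugation a b c habc) W ↔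
      (∀ t : ℝ, 0 ≤ t → W t = FockSpace.maxWCO (ξ t) (ζ t)) ∧
      ∃ A B C D : ℝ → ℂ,
        (∀ t : ℝ, 0 ≤ t → ∀ z : ℂ,
          ζ t z = A t * z + B t ∧ ξ t z = C t * Complex.exp (z * D t)) ∧
        (IsTranslationType a A B C D ∨ IsAffineExponentialType a b A B C D) := by
  constructor
  · rintro ⟨-, hs⟩
    have ha : a ≠ 0 := norm_ne_zero_iff.1 (by rw [habc.norm_a]; exact one_ne_zero)
    set A : ℝ → ℂ := fun t => ζ t 1 - ζ t 0 with hA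
    set B : ℝ → ℂ := fun t => ζ t 0 with hB
    set C : ℝ → ℂ := fun t => ξ t 0 with hC
    -- The other coefficients are read off at the points 0 and 1; `D` is defined by the
    -- compatibility relation that the symbol equation produces.
    set D : ℝ → ℂ := fun t => a * B t + b * (1 - A t) with hD
    have haff : ∀ t, 0 ≤ t → (∀ z, ζ t z = A t * z + B t) ∧ C t ≠ 0 ∧
        ∀ z, ξ t z = C t * Complex.exp (D t * z) := fun t ht =>
      FockSpace.affine_of_symbol_equation ha (hζ.entire t ht).continuous (hξ.exists_ne_zero hζ ht)
        fun z w => FockSpace.symbol_equation habc (hW t ht) (hs t ht) z w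
    have hAne : ∀ t, 0 ≤ t → A t ≠ 0 := fun t ht h => hζ.nonconstant t ht
      ⟨B t, fun z => by rw [(haff t ht).1, h, zero_mul, zero_add]⟩
    have hadd : ∀ t s : ℝ, 0 ≤ t → 0 ≤ s → ∀ z,
        ζ (t + s) z = A t * (A s * z + B s) + B t := fun t s ht hs z => by
      rw [hζ.add t s ht hs, (haff s hs).1, (haff t ht).1]
    refine ⟨fun t ht => FockSpace.eq_maxWCO_of_isCSelfadjoint habc (hAne t ht) (haff t ht).2.1 rfl
      (haff t ht).2.2 (haff t ht).1 (hW t ht) (hs t ht), A, B, C, D,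
      fun t ht z => ⟨(haff t ht).1 z, by rw [(haff t ht).2.2, mul_comm z]⟩,
      coefficient_types ((hζ.continuous 1).sub (hζ.continuous 0)) (hζ.continuous 0)
        (hξ.differentiable 0).continuousOn ?_ (hξ.zero 0) (fun t s ht hs => ?_)
        (fun t s ht hs => ?_) (fun t s ht hs => ?_) fun t _ => rfl⟩
    · simp [hA, hζ.zero]
    · change ζ (t + s) 1 - ζ (t + s) 0 = _
      rw [hadd t s ht hs, hadd t s ht hs]
      ring
    · change ζ (t + s) 0 = _
      rw [hadd t s ht hs]
      ring
    · change ξ (t + s) 0 = _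
      rw [hξ.add t s ht hs, (haff s hs).2.2 (ζ t 0), mul_assoc]
  · rintro ⟨hmax, A, B, C, D, hsym, htype⟩
    have hφ : ∀ t : ℝ, 0 ≤ t → ∀ z, ζ t z = A t * z + B t := fun t ht z => (hsym t ht z).1
    have hψ : ∀ t : ℝ, 0 ≤ t → ∀ z, ξ t z = C t * Complex.exp (D t * z) := fun t ht z => by
      rw [(hsym t ht z).2, mul_comm z]
    -- Both coefficient types satisfy the relation required of `D`, so each operator is selfadjoint
    -- by the general result.
    have hsa : ∀ t, 0 ≤ t → A t ≠ 0 → C t ≠ 0 → D t = a * B t + b * (1 - A t) →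
        IsCSelfadjoint (FockSpace.conjugation a b c habc) (W t) := fun t ht hA hC hD => by
      rw [hmax t ht]
      exact FockSpace.isCSelfadjoint_maxWCO habc hA hC hD (hψ t ht) (hφ t ht)
    rcases htype with ⟨E, F, h⟩ | ⟨l, G, K, -, h⟩
    · refine ⟨⟨_, FockSpace.isSemigroupVector_kernel_zero hζ hξ hmax hφ hψ
        (C' := fun t => Complex.exp (F * t + a * E ^ 2 * t ^ 2 / 2)) (D' := fun t => a * E * t)
        (by fun_prop) (by fun_prop) (fun t ht => (h t ht).2.2.2) (fun t ht => (h t ht).2.2.1)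
        (by simp) (by simp)⟩, fun t ht => ?_⟩
      obtain ⟨h1, h2, h3, h4⟩ := h t ht
      refine hsa t ht ?_ ?_ ?_
      · rw [h1]; exact one_ne_zero
      · rw [h4]; exact Complex.exp_ne_zero _
      · rw [h1, h2, h3]; ring
    · refine ⟨⟨_, FockSpace.isSemigroupVector_kernel_zero hζ hξ hmax hφ hψ
        (C' := fun t => Complex.exp (K * t + G * (a * G + b) * (Complex.exp (l * t) - l * t - 1)))
        (D' := fun t => (a * G + b) * (1 - Complex.exp (l * t)))
        (by fun_prop) (by fun_prop) (fun t ht => (h t ht).2.2.2) (fun t ht => (h t ht).2.2.1)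
        (by simp) (by simp)⟩, fun t ht => ?_⟩
      obtain ⟨h1, h2, h3, h4⟩ := h t ht
      refine hsa t ht ?_ ?_ ?_
      · rw [h1]; exact Complex.exp_ne_zero _
      · rw [h4]; exact Complex.exp_ne_zero _
      · rw [h1, h2, h3]; ring
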